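/- Graphs are finite and simple: a graph $\Gamma$ has a finite vertex set $V(\Gamma)$ and a set $E(\Gamma)$ of two-element subsets of $V(\Gamma)$. For a set $S$ of edges, $V(S)$ denotes the set of end points of the edges in $S$. **Measurement isomorphism.** Let $\Gamma$ have $e$ edges, and identify its edges with the coordinate axes of $\mathbb R^e$ by a bijection. The $d$-dimensional measurement set $M_d(\Gamma)\subseteq\mathbb R^e$ is the set of all vectors $\big(|p(u)-p(w)|^2\big)_{\{u,w\}\in E(\Gamma)}$, where $p$ runs over all maps $V(\Gamma)\to\mathbb E^d$. Two graphs $\Gamma,\Delta$ with the same number $e$ of edges are *$d$-measurement isomorphic* if, for some identifications of the edges of $\Gamma$ and of the edges of $\Delta$ with the coordinate axes of $\mathbb R^e$, one has $M_d(\Gamma)=M_d(\Delta)$. **2-isomorphism.** A *cut vertex* is a vertex $x$ whose removal disconnects the connected component that contains it. A *split* at a cut vertex $x$ takes a partition $\{S,T\}$ of the edge set with $V(S)\cap V(T)=\{x\}$ and replaces $x$ by two vertices $x',x''$, where the edges of $S$ at $x$ become incident with $x'$ and the edges of $T$ at $x$ become incident with $x''$. Two graphs are *1-isomorphic* if they become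 isomorphic after finite (possibly empty) sequences of splits. A *2-separation* is a partition $\{S,T\}$ of the edge set with $|S|\ge 2$, $|T|\ge 2$ and $V(S)\cap V(T)=\{x,y\}$ for two distinct vertices $x,y$; the corresponding *reversal* interchanges the incidences at $x$ and $y$ of the edges in $S$ and keeps the edges in $T$. Two graphs are *2-isomorphic* if they become 1-isomorphic after finite (possibly empty) sequences of reversals. **Theorem.** Let $d\ge 1$, and let $\Gamma$ and $\Delta$ be finite simple graphs with the same number of isolated vertices (for instance, none). Then $\Gamma$ and $\Delta$ are $d$-measurement isomorphic if and only if they are 2-isomorphic. -/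

import Mathlib

universe u v

namespace MeasIso

section Measurement

/-- The squared length `|p u - p w| ^ 2` of the pair `s(u, w)` in the configuration `p`. -/
noncomputable def sqLength {V : Type u} {d : ℕ} (p : V → EuclideanSpace ℝ (Fin d)) :
    Sym2 V → ℝ :=
  Sym2.lift ⟨fun a b => dist (p a) (p b) ^ 2, fun a b => by simp only [dist_comm]⟩

/-- The `d`-dimensional measurement set of `G` in `ℝ ^ n`, where `φ` identifies the edges of `G`
with the `n` coordinate axes: the set of all vectors of squared edge lengths, over all
configurations of the vertices in Euclidean `d`-space. -/
def measurementSet {V : Type u} (d : ℕ) (G : SimpleGraph V) {n : ℕ} (φ : G.edgeSet ≃ Fin n) :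
    Set (Fin n → ℝ) :=
  Set.range fun (p : V → EuclideanSpace ℝ (Fin d)) (i : Fin n) =>
    sqLength p (φ.symm i : Sym2 V)

/-- Both graphs have the same number of edges, and for suitable identifications of their edges
with the coordinate axes the two measurement sets are equal. -/
def MeasurementIsomorphic {V : Type u} {W : Type v} (d : ℕ)
    (G : SimpleGraph V) (H : SimpleGraph W) : Prop :=
  ∃ (n : ℕ) (φ : G.edgeSet ≃ Fin n) (ψ : H.edgeSet ≃ Fin n),
    measurementSet d G φ = measurementSet d H ψ

end Measurement

section TwoIsomorphism

/-- The vertices of the subgraph induced by a set `S` of edges: the end points of the members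
of `S`. -/
def edgeVerts {V : Type u} (S : Set (Sym2 V)) : Set V :=
  {a | ∃ e ∈ S, a ∈ e}

/-- `S` and `T` partition the edge set of `G`. -/
def IsEdgePartition {V : Type u} (G : SimpleGraph V) (S T : Set (Sym2 V)) : Prop :=
  S ∪ T = G.edgeSet ∧ Disjoint S T

/-- The removal of `x` disconnects the component of `G` that contains `x`: some two other vertices
that are joined by a walk in `G` are not joined by a walk in `G - x`. -/
def IsCutVertex {V : Type u} (G : SimpleGraph V) (x : V) : Prop :=
  ∃ (a b : V) (ha : a ≠ x) (hb : b ≠ x), G.Reachable a b ∧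
    ¬ (G.induce {w | w ≠ x}).Reachable ⟨a, ha⟩ ⟨b, hb⟩

open Classical in
/-- The graph in which the vertex `x` is broken into the two vertices `some x` and `none`: the edges
in `T` keep their end points, and those in `S` that end at `x` now end at `none`. -/
noncomputable def splitGraph {V : Type u} (x : V) (S T : Set (Sym2 V)) :
    SimpleGraph (Option V) :=
  SimpleGraph.fromEdgeSet
    (Sym2.map some '' T ∪ Sym2.map (fun a => if a = x then none else some a) '' S)

/-- `{S, T}` describes a split of `G` at the cut vertex `x`: an edge partition whose two sides
have exactly the vertex `x` in common, so that they become disjoint when `x` is broken up. -/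
def IsSplitting {V : Type u} (G : SimpleGraph V) (x : V) (S T : Set (Sym2 V)) : Prop :=
  IsCutVertex G x ∧ IsEdgePartition G S T ∧ edgeVerts S ∩ edgeVerts T = {x}

/-- `SplitsTo G H`: the graph `H` is obtained from `G` by a finite sequence of splits. -/
inductive SplitsTo : {V : Type u} → SimpleGraph V → {W : Type u} → SimpleGraph W → Prop
  | refl {V : Type u} (G : SimpleGraph V) : SplitsTo G G
  | step {V W : Type u} (G : SimpleGraph V) (x : V) (S T : Set (Sym2 V)) (H : SimpleGraph W) :
      IsSplitting G x S T → SplitsTo (splitGraph x S T) H → SplitsTo G H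

/-- The two graphs become isomorphic under finite sequences of splits. -/
def OneIsomorphic {V : Type u} {W : Type v} (G : SimpleGraph V) (H : SimpleGraph W) : Prop :=
  ∃ (V' : Type u) (G' : SimpleGraph V') (W' : Type v) (H' : SimpleGraph W'),
    SplitsTo G G' ∧ SplitsTo H H' ∧ Nonempty (G' ≃g H')

/-- `{S, T}` is a 2-separation of `G` with cut pair `{x, y}`. -/
def IsTwoSeparation {V : Type u} (G : SimpleGraph V) (S T : Set (Sym2 V)) (x y : V) : Prop :=
  IsEdgePartition G S T ∧ 2 ≤ S.encard ∧ 2 ≤ T.encard ∧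
    x ≠ y ∧ edgeVerts S ∩ edgeVerts T = {x, y}

open Classical in
/-- The graph obtained by interchanging the incidences at `x` and `y` of the edges in `S`, and
keeping the edges in `T`. -/
noncomputable def reversalGraph {V : Type u} (S T : Set (Sym2 V)) (x y : V) : SimpleGraph V :=
  SimpleGraph.fromEdgeSet (T ∪ Sym2.map (Equiv.swap x y) '' S)

/-- `G'` is obtained from `G` by one reversal. -/
def IsReversal {V : Type u} (G G' : SimpleGraph V) : Prop :=
  ∃ (S T : Set (Sym2 V)) (x y : V), IsTwoSeparation G S T x y ∧ G' = reversalGraph S T x y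

/-- The two graphs become 1-isomorphic after finite sequences of reversals. -/
def TwoIsomorphic {V : Type u} {W : Type v} (G : SimpleGraph V) (H : SimpleGraph W) : Prop :=
  ∃ (G' : SimpleGraph V) (H' : SimpleGraph W),
    Relation.ReflTransGen IsReversal G G' ∧ Relation.ReflTransGen IsReversal H H' ∧
      OneIsomorphic G' H'

end TwoIsomorphism

end MeasIso

namespace MeasIso

open Set Relation

/-! ### Cut spaces, boundaries and reversals of edge-labelled multigraphs. -/

section Basics

variable {E V W : Type*}

/-! The bridge between the two notions is the mod 2 cut space of the graph, that is, the set of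
coboundaries of Boolean vertex potentials.

Measurements determine cuts. Placing the two sides of a cut at two distinct points gives a
measurement whose support is the cut; conversely, if a configuration gives an edge nonzero length,
the vertices at the position of one of its ends define a cut through that edge inside the support.
So the minimal nonempty supports are the minimal nonempty cuts, and these span the cut space
(`cutSpace_subset_of_measurements_eq`).

Cuts determine the graph up to 2-isomorphism: this is Whitney's theorem, proved here for labelled
multigraphs. For a connected cut space (`exists_reversals_lIso`) the induction is on the number of
non-isolated vertices. If no two vertices separate `f`, every vertex star of `f` is a vertex star of
`g` (`star_match`), and the stars determine the graph. Otherwise `f` has a 2-separation with side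
`S`. The cut space then almost splits along `S`, and this alone allows reversals of `g` that leave
`S` with only two attachments (`exists_reversals_ncard_boundary_le_two`). Each side, with the other
side collapsed to parallel edges joining the cut pair, has fewer vertices. The reversals supplied by
induction lift to the whole graph (`exists_lift_reversals`), and at most one more reversal glues the
two sides (`exists_reversals_lIso_of_sides`).

For a general cut space the blocks are treated one at a time by lifting their reversals
(`exists_reversals_lIsoOn_block`). Both graphs are then split completely into blocks, and the
isomorphisms of blocks combine (`FullySplit.lIso`). The equal numbers of isolated vertices extend
the result to all vertices.

For the converse, a reversal is undone geometrically by a point reflection of one side, and a split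
by a translation of one side, so neither changes the measurement set (`measurements_swapOn`,
`measurements_splitAt`). -/

theorem xor_xor_xor_comm (a b c d : Bool) : ((a ^^ b) ^^ (c ^^ d)) = ((a ^^ c) ^^ (b ^^ d)) := by
  decide +revert

theorem xor_xor_cancel (a b c : Bool) : ((a ^^ c) ^^ (b ^^ c)) = (a ^^ b) := by
  decide +revert

theorem xor_self_xor (a b : Bool) : (b ^^ (a ^^ b)) = a := by
  decide +revert

/-- The mod 2 coboundary of a potential `p` on the vertices of the labelled graph `f`. -/
def coboundary (f : E → Sym2 V) (p : V → Bool) (e : E) : Bool :=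
  Sym2.lift ⟨fun a b => p a ^^ p b, fun _ _ => Bool.xor_comm _ _⟩ (f e)

theorem coboundary_mk {f : E → Sym2 V} {e : E} {a b : V} (h : f e = s(a, b)) (p : V → Bool) :
    coboundary f p e = (p a ^^ p b) := by
  simp [coboundary, h]

/-- The mod 2 cut space of a labelled graph. -/
def cutSpace (f : E → Sym2 V) : Set (E → Bool) := range (coboundary f)

theorem coboundary_mem (f : E → Sym2 V) (p : V → Bool) : coboundary f p ∈ cutSpace f := ⟨p, rfl⟩

theorem exists_ends (f : E → Sym2 V) (e : E) : ∃ a b, f e = s(a, b) := by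
  induction h : f e with
  | _ a b => exact ⟨a, b, rfl⟩

theorem exists_other {f : E → Sym2 V} {e : E} {a : V} (h : a ∈ f e) : ∃ b, f e = s(a, b) := by
  obtain ⟨b, hb⟩ := h
  exact ⟨b, hb⟩

theorem coboundary_xor (f : E → Sym2 V) (p q : V → Bool) (e : E) :
    coboundary f (fun v => p v ^^ q v) e = (coboundary f p e ^^ coboundary f q e) := by
  obtain ⟨a, b, h⟩ := exists_ends f e
  simp only [coboundary_mk h]
  exact xor_xor_xor_comm _ _ _ _

theorem cutSpace_xor {f : E → Sym2 V} {c d : E → Bool} (hc : c ∈ cutSpace f)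
    (hd : d ∈ cutSpace f) : (fun e => c e ^^ d e) ∈ cutSpace f := by
  obtain ⟨p, rfl⟩ := hc
  obtain ⟨q, rfl⟩ := hd
  exact ⟨_, funext (coboundary_xor f p q)⟩

/-- The non-isolated vertices. -/
def verts (f : E → Sym2 V) : Set V := {v | ∃ e, v ∈ f e}

/-- The vertices shared by the edges in `P` and the edges outside `P`. -/
def boundary (f : E → Sym2 V) (P : Set E) : Set V := {v | (∃ e ∈ P, v ∈ f e) ∧ ∃ e ∉ P, v ∈ f e}

theorem mem_boundary {f : E → Sym2 V} {P : Set E} {e e' : E} {v : V} (h : e ∈ P) (h' : e' ∉ P)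
    (hv : v ∈ f e) (hv' : v ∈ f e') : v ∈ boundary f P := ⟨⟨e, h, hv⟩, e', h', hv'⟩

theorem boundary_compl (f : E → Sym2 V) (P : Set E) : boundary f Pᶜ = boundary f P := by
  ext v
  simp [boundary, and_comm]

/-- No edge is a loop. -/
def Loopless (f : E → Sym2 V) : Prop := ∀ e, ¬ (f e).IsDiag

theorem Loopless.ne {f : E → Sym2 V} (hf : Loopless f) {e : E} {a b : V} (h : f e = s(a, b)) :
    a ≠ b := by
  have := hf e
  rw [h] at this
  simpa using this

/-- The restriction of `c` to `P`, extended by zero, lies in the space `C`. -/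
def PartMem (C : Set (E → Bool)) (P : Set E) (c : E → Bool) : Prop :=
  ∃ c' ∈ C, (∀ e ∈ P, c' e = c e) ∧ ∀ e ∉ P, c' e = false

/-- The space `C` is the direct sum of its parts on `P` and on the complement of `P`. -/
def Splits (C : Set (E → Bool)) (P : Set E) : Prop := ∀ c ∈ C, PartMem C P c

/-- The space `C` does not split in a nontrivial way. -/
def Conn (C : Set (E → Bool)) : Prop := ∀ P, Splits C P → P = ∅ ∨ P = univ

theorem PartMem.xor {f : E → Sym2 V} {P : Set E} {c d : E → Bool}
    (hc : PartMem (cutSpace f) P c) (hd : PartMem (cutSpace f) P d) :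
    PartMem (cutSpace f) P (fun e => c e ^^ d e) := by
  obtain ⟨c', hc', h1, h2⟩ := hc
  obtain ⟨d', hd', h3, h4⟩ := hd
  refine ⟨_, cutSpace_xor hc' hd', fun e he => ?_, fun e he => ?_⟩
  · simp [h1 e he, h3 e he]
  · simp [h2 e he, h4 e he]

/-- A potential may be shifted by a constant so that it vanishes at `z`. It can then be cut off to
zero outside the vertices of `P`, because `z` is the only vertex where the two parts can meet. -/
theorem splits_of_boundary_subset {f : E → Sym2 V} {P : Set E} {z : V}
    (h : boundary f P ⊆ {z}) : Splits (cutSpace f) P := by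
  classical
  rintro _ ⟨p, rfl⟩
  refine ⟨_, coboundary_mem f fun u => if ∃ e ∈ P, u ∈ f e then p u ^^ p z else false, ?_, ?_⟩
  · intro e he
    obtain ⟨a, b, hab⟩ := exists_ends f e
    rw [coboundary_mk hab, coboundary_mk hab, if_pos ⟨e, he, by simp [hab]⟩,
      if_pos ⟨e, he, by simp [hab]⟩, xor_xor_cancel]
  · intro e he
    have key : ∀ a ∈ f e, (if ∃ e ∈ P, a ∈ f e then p a ^^ p z else false) = false := by
      intro a ha
      split_ifs with h'
      · have : a ∈ boundary f P := ⟨h', e, he, ha⟩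
        rw [h this]
        simp
      · rfl
    obtain ⟨a, b, hab⟩ := exists_ends f e
    rw [coboundary_mk hab, key a (by simp [hab]), key b (by simp [hab])]
    rfl

theorem Conn.eq_empty_or_univ {f : E → Sym2 V} (hC : Conn (cutSpace f)) {P : Set E} {z : V}
    (h : boundary f P ⊆ {z}) : P = ∅ ∨ P = univ :=
  hC P (splits_of_boundary_subset h)

/-- The edges with an end other than `v` on the side `q = true` meet the remaining edges only at
`v`, so they are none or all of the edges. -/
theorem const_off_vertex {f : E → Sym2 V}
    (hC : ∀ P z, boundary f P ⊆ {z} → P = ∅ ∨ P = univ) (v : V)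
    {q : V → Bool} (hq : ∀ e, v ∉ f e → coboundary f q e = false) :
    ∃ t, ∀ u ∈ verts f, u ≠ v → q u = t := by
  have key : ∀ e u u', u ∈ f e → u' ∈ f e → u ≠ v → u' ≠ v → q u = q u' := by
    intro e u u' hu hu' hne hne'
    obtain ⟨b, hb⟩ := exists_other hu
    rw [hb, Sym2.mem_iff] at hu'
    rcases hu' with rfl | rfl
    · rfl
    · have := hq e (by rw [hb, Sym2.mem_iff]; tauto)
      rw [coboundary_mk hb] at this
      grind
  have := hC {e | ∃ u ∈ f e, u ≠ v ∧ q u = true} v (by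
    rintro w ⟨⟨e, ⟨u, hu, huv, hqu⟩, hw⟩, e', he', hw'⟩
    by_contra hwv
    exact he' ⟨w, hw', hwv, (key e w u hw hu hwv huv).trans hqu⟩)
  rcases this with h | h
  · refine ⟨false, ?_⟩
    rintro u ⟨e, he⟩ huv
    by_contra hqu
    have : e ∈ (∅ : Set E) := h ▸ (show e ∈ {e | ∃ u ∈ f e, u ≠ v ∧ q u = true} from
      ⟨u, he, huv, by simpa using hqu⟩)
    exact this
  · refine ⟨true, ?_⟩
    rintro u ⟨e, he⟩ huv
    obtain ⟨u', hu', h1, h2⟩ : e ∈ {e | ∃ u ∈ f e, u ≠ v ∧ q u = true} := h ▸ mem_univ e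
    exact (key e u u' he hu' huv h1).trans h2

theorem Conn.const_off {f : E → Sym2 V} (hC : Conn (cutSpace f)) (v : V)
    {q : V → Bool} (hq : ∀ e, v ∉ f e → coboundary f q e = false) :
    ∃ t, ∀ u ∈ verts f, u ≠ v → q u = t :=
  const_off_vertex (fun _ _ h => hC.eq_empty_or_univ h) v hq

/-- Constancy away from one end `a` of an edge already covers the other end, and that edge then
forces the same value at `a`. -/
theorem Conn.const {f : E → Sym2 V} (hC : Conn (cutSpace f)) (hl : Loopless f)
    {q : V → Bool} (hq : ∀ e, coboundary f q e = false) :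
    ∃ t, ∀ u ∈ verts f, q u = t := by
  by_cases hE : Nonempty E
  · obtain ⟨e⟩ := hE
    obtain ⟨a, b, hab⟩ := exists_ends f e
    obtain ⟨t, ht⟩ := hC.const_off a fun e _ => hq e
    refine ⟨t, fun u hu => ?_⟩
    by_cases hua : u = a
    · have h1 := ht b ⟨e, by simp [hab]⟩ (hl.ne hab).symm
      have h2 := hq e
      rw [coboundary_mk hab] at h2
      grind
    · exact ht u hu hua
  · exact ⟨false, fun u ⟨e, _⟩ => (hE ⟨e⟩).elim⟩

open Classical in
/-- The indicator of a vertex. -/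
noncomputable def single (v : V) : V → Bool := fun u => decide (u = v)

theorem coboundary_single {f : E → Sym2 V} (hl : Loopless f) (v : V) (e : E) :
    coboundary f (single v) e = true ↔ v ∈ f e := by
  obtain ⟨a, b, hab⟩ := exists_ends f e
  have := hl.ne hab
  rw [coboundary_mk hab, hab, Sym2.mem_iff]
  simp only [single]
  grind

theorem coboundary_single_false {f : E → Sym2 V} (hl : Loopless f) {v : V} {e : E} (h : v ∉ f e) :
    coboundary f (single v) e = false := by
  rw [← Bool.not_eq_true, coboundary_single hl]
  exact h

/-- A part of the star at a vertex `v` is not a cut, if it is a proper part. -/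
theorem not_partMem_single {f : E → Sym2 V} (hl : Loopless f)
    (hC : ∀ P z, boundary f P ⊆ {z} → P = ∅ ∨ P = univ) {S : Set E} {v : V}
    (hv : v ∈ boundary f S) : ¬ PartMem (cutSpace f) S (coboundary f (single v)) := by
  rintro ⟨_, ⟨q, rfl⟩, h1, h2⟩
  obtain ⟨t, ht⟩ := const_off_vertex hC v (q := q) (by
    intro e he
    by_cases hS : e ∈ S
    · rw [h1 e hS, coboundary_single_false hl he]
    · exact h2 e hS)
  have key : ∀ e, v ∈ f e → coboundary f q e = (q v ^^ t) := by
    intro e he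
    obtain ⟨b, hb⟩ := exists_other he
    rw [coboundary_mk hb, ht b ⟨e, by simp [hb]⟩ (hl.ne hb).symm]
  obtain ⟨⟨e, he, hve⟩, e', he', hve'⟩ := hv
  have h3 := h1 e he
  rw [key e hve, (coboundary_single hl v e).2 hve] at h3
  have h4 := h2 e' he'
  rw [key e' hve'] at h4
  simp [h3] at h4

/-- If the space splits along `P`, the star of any boundary vertex would restrict to a cut, which is
impossible. Hence the boundary of `P` is empty. This makes connectedness a condition on separating
vertices. -/
theorem conn_of_boundary {f : E → Sym2 V} (hl : Loopless f)
    (hC : ∀ P z, boundary f P ⊆ {z} → P = ∅ ∨ P = univ) : Conn (cutSpace f) := by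
  intro P hP
  by_cases hE : Nonempty E
  · obtain ⟨e⟩ := hE
    obtain ⟨a, b, hab⟩ := exists_ends f e
    refine hC P a ?_
    intro v hv
    exact (not_partMem_single hl hC hv (hP _ (coboundary_mem f _))).elim
  · left
    ext e
    exact (hE ⟨e⟩).elim

/-- Labelled graphs are isomorphic up to isolated vertices. -/
def LIso (f : E → Sym2 V) (g : E → Sym2 W) : Prop :=
  ∃ σ : V → W, InjOn σ (verts f) ∧ ∀ e, g e = (f e).map σ

theorem LIso.refl (f : E → Sym2 V) : LIso f f := ⟨id, injOn_id _, by simp⟩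

theorem verts_map {f : E → Sym2 V} {g : E → Sym2 W} {σ : V → W}
    (h : ∀ e, g e = (f e).map σ) : verts g = σ '' verts f := by
  ext w
  simp only [verts, h, Sym2.mem_map, mem_ofPred_eq, mem_image]
  grind

theorem LIso.trans {X : Type*} {f : E → Sym2 V} {g : E → Sym2 W} {h : E → Sym2 X}
    (hfg : LIso f g) (hgh : LIso g h) : LIso f h := by
  obtain ⟨σ, hσ, h1⟩ := hfg
  obtain ⟨τ, hτ, h2⟩ := hgh
  rw [verts_map h1] at hτ
  refine ⟨τ ∘ σ, hτ.comp hσ (mapsTo_image _ _), fun e => ?_⟩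
  rw [h2, h1, Sym2.map_map]

theorem sym2_map_eq_self {σ : V → V} {z : Sym2 V} (h : ∀ v ∈ z, σ v = v) : z.map σ = z := by
  induction z with
  | _ a b => rw [Sym2.map_mk, h a (by simp), h b (by simp)]

theorem sym2_map_congr {σ τ : V → W} {z : Sym2 V} (h : ∀ v ∈ z, σ v = τ v) :
    z.map σ = z.map τ := by
  induction z with
  | _ a b => rw [Sym2.map_mk, Sym2.map_mk, h a (by simp), h b (by simp)]

theorem LIso.symm [Nonempty E] {f : E → Sym2 V} {g : E → Sym2 W} (h : LIso f g) : LIso g f := by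
  obtain ⟨σ, hσ, h⟩ := h
  obtain ⟨e⟩ := ‹Nonempty E›
  obtain ⟨a, _, _⟩ := exists_ends f e
  have : Nonempty V := ⟨a⟩
  refine ⟨Function.invFunOn σ (verts f), ?_, fun e => ?_⟩
  · rw [verts_map h]
    exact (Function.invFunOn_injOn_image _ _)
  · rw [h, Sym2.map_map]
    refine (sym2_map_eq_self fun v hv => ?_).symm
    exact hσ.leftInvOn_invFunOn ⟨e, hv⟩

theorem LIso.ncard_verts {f : E → Sym2 V} {g : E → Sym2 W} (h : LIso f g) :
    (verts g).ncard = (verts f).ncard := by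
  obtain ⟨σ, hσ, h⟩ := h
  rw [verts_map h, hσ.ncard_image]

theorem lIso_of_equiv {f : E → Sym2 V} {g : E → Sym2 W} (σ : V ≃ W)
    (h : ∀ e, g e = (f e).map σ) : LIso f g :=
  ⟨σ, σ.injective.injOn, h⟩

open Classical in
/-- Interchange the incidences at `a` and `b` of the edges in `P`. -/
noncomputable def swapOn (f : E → Sym2 V) (P : Set E) (a b : V) : E → Sym2 V :=
  fun e => if e ∈ P then (f e).map (Equiv.swap a b) else f e

/-- The labelled graph `f'` arises from `f` by a reversal. -/
def Reversal (f f' : E → Sym2 V) : Prop :=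
  ∃ (P : Set E) (a b : V), a ≠ b ∧ boundary f P = {a, b} ∧ f' = swapOn f P a b

open Classical in
theorem swapOn_mem {f : E → Sym2 V} {P : Set E} {a b : V} {e : E} (h : e ∈ P) :
    swapOn f P a b e = (f e).map (Equiv.swap a b) := by
  simp [swapOn, h]

theorem swapOn_notMem {f : E → Sym2 V} {P : Set E} {a b : V} {e : E} (h : e ∉ P) :
    swapOn f P a b e = f e := by simp [swapOn, h]

theorem mem_map_swap {a b v : V} {z : Sym2 V} [DecidableEq V] :
    v ∈ z.map (Equiv.swap a b) ↔ Equiv.swap a b v ∈ z := by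
  rw [Sym2.mem_map]
  constructor
  · rintro ⟨u, hu, rfl⟩
    simpa using hu
  · intro h
    exact ⟨_, h, by simp⟩

open Classical in
theorem swapOn_swapOn (f : E → Sym2 V) (P : Set E) (a b : V) :
    swapOn (swapOn f P a b) P a b = f := by
  funext e
  by_cases h : e ∈ P
  · rw [swapOn_mem h, swapOn_mem h, Sym2.map_map]
    exact sym2_map_eq_self fun v _ => by simp
  · rw [swapOn_notMem h, swapOn_notMem h]

open Classical in
theorem exists_mem_swapOn {f : E → Sym2 V} {P : Set E} {a b : V}
    (ha : a ∈ boundary f P) (hb : b ∈ boundary f P) (v : V) :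
    (∃ e ∈ P, v ∈ swapOn f P a b e) ↔ ∃ e ∈ P, v ∈ f e := by
  have : (∃ e ∈ P, v ∈ swapOn f P a b e) ↔ ∃ e ∈ P, Equiv.swap a b v ∈ f e := by
    refine exists_congr fun e => and_congr_right fun he => ?_
    rw [swapOn_mem he, mem_map_swap]
  rw [this]
  by_cases hva : v = a
  · subst hva
    simp only [Equiv.swap_apply_left]
    exact ⟨fun _ => ha.1, fun _ => hb.1⟩
  · by_cases hvb : v = b
    · subst hvb
      simp only [Equiv.swap_apply_right]
      exact ⟨fun _ => hb.1, fun _ => ha.1⟩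
    · rw [Equiv.swap_apply_of_ne_of_ne hva hvb]

theorem exists_notMem_swapOn {f : E → Sym2 V} {P : Set E} {a b : V} (v : V) :
    (∃ e ∉ P, v ∈ swapOn f P a b e) ↔ ∃ e ∉ P, v ∈ f e := by
  refine exists_congr fun e => and_congr_right fun he => ?_
  rw [swapOn_notMem he]

theorem boundary_swapOn {f : E → Sym2 V} {P : Set E} {a b : V}
    (ha : a ∈ boundary f P) (hb : b ∈ boundary f P) :
    boundary (swapOn f P a b) P = boundary f P := by
  ext v
  exact and_congr (exists_mem_swapOn ha hb v) (exists_notMem_swapOn v)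

theorem verts_swapOn {f : E → Sym2 V} {P : Set E} {a b : V}
    (ha : a ∈ boundary f P) (hb : b ∈ boundary f P) :
    verts (swapOn f P a b) = verts f := by
  have key : ∀ (g : E → Sym2 V) v, v ∈ verts g ↔ (∃ e ∈ P, v ∈ g e) ∨ ∃ e ∉ P, v ∈ g e := by
    intro g v
    simp only [verts, mem_ofPred_eq]
    grind
  ext v
  rw [key, key, exists_mem_swapOn ha hb, exists_notMem_swapOn]

-- On the vertices of `P`, the transposed potential plus the constant `p a ^^ p b` takes the
-- original values at `a` and `b`, so it glues to `p` outside `P`.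
open Classical in
theorem cutSpace_swapOn_subset {f : E → Sym2 V} {P : Set E} {a b : V}
    (h : boundary f P = {a, b}) : cutSpace (swapOn f P a b) ⊆ cutSpace f := by
  rintro _ ⟨p, rfl⟩
  set q : V → Bool := fun v =>
    if ∃ e ∈ P, v ∈ f e then p (Equiv.swap a b v) ^^ (p a ^^ p b) else p v with hq
  refine ⟨q, funext fun e => ?_⟩
  by_cases he : e ∈ P
  · obtain ⟨u, w, huw⟩ := exists_ends f e
    have h' : swapOn f P a b e = s(Equiv.swap a b u, Equiv.swap a b w) := by
      rw [swapOn_mem he, huw, Sym2.map_mk]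
    rw [coboundary_mk huw, coboundary_mk h']
    simp only [hq]
    rw [if_pos ⟨e, he, by simp [huw]⟩, if_pos ⟨e, he, by simp [huw]⟩, xor_xor_cancel]
  · have key : ∀ u ∈ f e, q u = p u := by
      intro u hu
      simp only [hq]
      split_ifs with h1
      · have : u ∈ boundary f P := ⟨h1, e, he, hu⟩
        rw [h] at this
        rcases this with rfl | rfl
        · simp [xor_self_xor]
        · simp
      · rfl
    obtain ⟨u, w, huw⟩ := exists_ends f e
    have h' : swapOn f P a b e = s(u, w) := by rw [swapOn_notMem he, huw]
    rw [coboundary_mk huw, coboundary_mk h', key u (by simp [huw]), key w (by simp [huw])]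

theorem Reversal.cutSpace_eq {f f' : E → Sym2 V} (h : Reversal f f') :
    cutSpace f' = cutSpace f := by
  obtain ⟨P, a, b, hab, hP, rfl⟩ := h
  refine (cutSpace_swapOn_subset hP).antisymm ?_
  have h2 : boundary (swapOn f P a b) P = {a, b} := by
    rw [boundary_swapOn (by simp [hP]) (by simp [hP]), hP]
  have := cutSpace_swapOn_subset h2
  rwa [swapOn_swapOn] at this

open Classical in
theorem Reversal.loopless {f f' : E → Sym2 V} (h : Reversal f f') (hl : Loopless f) :
    Loopless f' := by
  obtain ⟨P, a, b, hab, hP, rfl⟩ := h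
  intro e
  by_cases he : e ∈ P
  · obtain ⟨u, w, huw⟩ := exists_ends f e
    have := hl.ne huw
    rw [swapOn_mem he, huw, Sym2.map_mk]
    simpa using this
  · rw [swapOn_notMem he]
    exact hl e

theorem Reversal.verts_eq {f f' : E → Sym2 V} (h : Reversal f f') : verts f' = verts f := by
  obtain ⟨P, a, b, hab, hP, rfl⟩ := h
  exact verts_swapOn (by simp [hP]) (by simp [hP])

theorem cutSpace_eq_of_reversals {f f' : E → Sym2 V} (h : ReflTransGen Reversal f f') :
    cutSpace f' = cutSpace f := by
  induction h with
  | refl => rfl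
  | tail _ h ih => rw [h.cutSpace_eq, ih]

theorem loopless_of_reversals {f f' : E → Sym2 V} (h : ReflTransGen Reversal f f')
    (hl : Loopless f) : Loopless f' := by
  induction h with
  | refl => exact hl
  | tail _ h ih => exact h.loopless ih

theorem verts_eq_of_reversals {f f' : E → Sym2 V} (h : ReflTransGen Reversal f f') :
    verts f' = verts f := by
  induction h with
  | refl => rfl
  | tail _ h ih => rw [h.verts_eq, ih]

end Basics

/-! ### Graphs without separating vertex pairs: stars are recovered from the cut space. -/

section Stars

variable {E V W : Type*}

/-- No two vertices separate the labelled graph. -/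
def NoVertexPairCut (f : E → Sym2 V) : Prop :=
  ∀ (x y : V) (q : V → Bool), (∀ e, x ∉ f e → y ∉ f e → coboundary f q e = false) →
    ∃ t, ∀ u ∈ verts f, u ≠ x → u ≠ y → q u = t

/-- A cut contained in the star of `v` is empty or all of the star. -/
theorem cut_le_star {f : E → Sym2 V} (hl : Loopless f) (hC : Conn (cutSpace f)) {v : V}
    {q : V → Bool} (hq : ∀ e, coboundary f q e = true → v ∈ f e) {e₀ : E}
    (h₀ : coboundary f q e₀ = true) (e : E) : coboundary f q e = true ↔ v ∈ f e := by
  obtain ⟨t, ht⟩ := hC.const_off v (q := q) fun e he => by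
    rw [← Bool.not_eq_true]
    exact fun h => he (hq e h)
  have key : ∀ e, v ∈ f e → coboundary f q e = (q v ^^ t) := by
    intro e he
    obtain ⟨b, hb⟩ := exists_other he
    rw [coboundary_mk hb, ht b ⟨e, by simp [hb]⟩ (hl.ne hb).symm]
  refine ⟨hq e, fun he => ?_⟩
  rw [key e he, ← key e₀ (hq _ h₀), h₀]

theorem coboundary_not (f : E → Sym2 V) (q : V → Bool) :
    coboundary f (fun u => !q u) = coboundary f q := by
  funext e
  obtain ⟨a, b, hab⟩ := exists_ends f e
  simp [coboundary_mk hab]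

theorem eq_of_coboundary_eq_false {f : E → Sym2 V} {q : V → Bool} {e : E} {a b : V}
    (h : f e = s(a, b)) (hq : coboundary f q e = false) : q a = q b := by
  rw [coboundary_mk h] at hq
  simpa using hq

/-- If no edge of `g` lies on the side `p = true` of the cut that is a star of `f`, then this side
is a vertex. -/
theorem star_match_of_side {f : E → Sym2 V} {g : E → Sym2 W} (hlf : Loopless f)
    (hlg : Loopless g) (hC : cutSpace f = cutSpace g) (hconn : Conn (cutSpace f)) {v : V}
    (hv : v ∈ verts f) {p : W → Bool} (hp : coboundary g p = coboundary f (single v))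
    (hside : ∀ e w w', g e = s(w, w') → p w = true → p w' = false) :
    ∃ w, ∀ e, w ∈ g e ↔ v ∈ f e := by
  obtain ⟨e₀, h₀⟩ := hv
  have h1 : coboundary g p e₀ = true := by rw [hp, coboundary_single hlf]; exact h₀
  obtain ⟨w, hw, hpw⟩ : ∃ w ∈ g e₀, p w = true := by
    obtain ⟨a, b, hab⟩ := exists_ends g e₀
    rw [coboundary_mk hab] at h1
    cases ha : p a
    · exact ⟨b, by simp [hab], by simpa [ha] using h1⟩
    · exact ⟨a, by simp [hab], ha⟩
  obtain ⟨q, hq⟩ : coboundary g (single w) ∈ cutSpace f := hC ▸ coboundary_mem g _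
  refine ⟨w, fun e => ?_⟩
  rw [← coboundary_single hlg, ← hq]
  refine cut_le_star hlf hconn (fun e he => ?_) (e₀ := e₀) ?_ e
  · rw [hq, coboundary_single hlg] at he
    obtain ⟨b, hb⟩ := exists_other he
    rw [← coboundary_single hlf, ← hp, coboundary_mk hb, hpw, hside e w b hb hpw]
    rfl
  · rw [hq, coboundary_single hlg]
    exact hw

/-- If no two vertices separate `f`, then every star of `f` is a star of `g`. -/
theorem star_match {f : E → Sym2 V} {g : E → Sym2 W} (hlf : Loopless f)
    (hlg : Loopless g) (hC : cutSpace f = cutSpace g) (hconn : Conn (cutSpace f))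
    (h3 : NoVertexPairCut f) {v : V} (hv : v ∈ verts f) :
    ∃ w, ∀ e, w ∈ g e ↔ v ∈ f e := by
  obtain ⟨p, hp⟩ : coboundary f (single v) ∈ cutSpace g := hC ▸ coboundary_mem f _
  have hD : ∀ e w w', g e = s(w, w') → v ∉ f e → p w = p w' := by
    intro e w w' h hve
    refine eq_of_coboundary_eq_false h ?_
    rw [hp, coboundary_single_false hlf hve]
  -- the edges avoiding `v` on one side of the cut
  set A : Set E := {e | v ∉ f e ∧ ∀ w ∈ g e, p w = true} with hA
  have hA' : ∀ e, v ∉ f e → e ∉ A → ∀ w ∈ g e, p w = false := by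
    intro e hve he w hw
    by_contra hpw
    obtain ⟨b, hb⟩ := exists_other hw
    refine he ⟨hve, fun w' hw' => ?_⟩
    rw [hb, Sym2.mem_iff] at hw'
    rcases hw' with rfl | rfl
    · simpa using hpw
    · rw [← hD e w w' hb hve]
      simpa using hpw
  have hstar : ∀ u ∈ verts f, u ≠ v → ∃ t : Bool, ∀ e, u ∈ f e → v ∉ f e →
      (e ∈ A ↔ t = true) := by
    intro u hu huv
    obtain ⟨r, hr⟩ : coboundary f (single u) ∈ cutSpace g := hC ▸ coboundary_mem f _
    -- Truncating `r` to the side `p = true` keeps the star of `u` on `A` and removes it on the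
    -- other edges avoiding `v`. As a cut of `f`, the result is constant off `u` and `v`, so the
    -- edges at `u` avoiding `v` cannot lie on both sides.
    obtain ⟨q, hq⟩ : coboundary g (fun w => r w && p w) ∈ cutSpace f := hC ▸ coboundary_mem g _
    have hqA : ∀ e ∈ A, coboundary f q e = coboundary f (single u) e := by
      intro e he
      obtain ⟨a, b, hab⟩ := exists_ends g e
      rw [hq, ← hr, coboundary_mk hab, coboundary_mk hab, he.2 a (by simp [hab]),
        he.2 b (by simp [hab]), Bool.and_true, Bool.and_true]
    have hqB : ∀ e, v ∉ f e → e ∉ A → coboundary f q e = false := by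
      intro e hve he
      obtain ⟨a, b, hab⟩ := exists_ends g e
      rw [hq, coboundary_mk hab, hA' e hve he a (by simp [hab]), hA' e hve he b (by simp [hab])]
      simp
    obtain ⟨t, ht⟩ := h3 u v q fun e hue hve => by
      by_cases he : e ∈ A
      · rw [hqA e he, coboundary_single_false hlf hue]
      · exact hqB e hve he
    refine ⟨q u ^^ t, fun e hue hve => ?_⟩
    obtain ⟨b, hb⟩ := exists_other hue
    have hbv : b ≠ v := by
      rintro rfl
      exact hve (by simp [hb])
    rw [← ht b ⟨e, by simp [hb]⟩ (hlf.ne hb).symm hbv, ← coboundary_mk hb]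
    by_cases he : e ∈ A
    · simp [he, hqA e he, (coboundary_single hlf u e).2 hue]
    · simp [he, hqB e hve he]
  choose! t ht using hstar
  obtain ⟨t', ht'⟩ := hconn.const_off v (q := t) fun e hve => by
    obtain ⟨a, b, hab⟩ := exists_ends f e
    have ha : a ≠ v := by rintro rfl; exact hve (by simp [hab])
    have hb : b ≠ v := by rintro rfl; exact hve (by simp [hab])
    have h1 := ht a ⟨e, by simp [hab]⟩ ha e (by simp [hab]) hve
    have h2 := ht b ⟨e, by simp [hab]⟩ hb e (by simp [hab]) hve
    rw [coboundary_mk hab]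
    have := h1.symm.trans h2
    cases h3 : t a <;> cases h4 : t b <;> simp_all
  have hAt : ∀ e, v ∉ f e → (e ∈ A ↔ t' = true) := by
    intro e hve
    obtain ⟨a, b, hab⟩ := exists_ends f e
    have ha : a ≠ v := by rintro rfl; exact hve (by simp [hab])
    rw [ht a ⟨e, by simp [hab]⟩ ha e (by simp [hab]) hve, ht' a ⟨e, by simp [hab]⟩ ha]
  have hcross : ∀ e w w', g e = s(w, w') → v ∈ f e → p w ≠ p w' := by
    intro e w w' h hve heq
    rw [← coboundary_single hlf, ← hp, coboundary_mk h, heq] at hve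
    simp at hve
  cases ht'' : t'
  -- All edges avoiding `v` lie on one side of the cut in `g`, so the other side contains no edge.
  -- In the second case the sides are exchanged by negating `p`.
  · refine star_match_of_side hlf hlg hC hconn hv hp fun e w w' h hw => ?_
    by_cases hve : v ∈ f e
    · have := hcross e w w' h hve
      rw [hw] at this
      simpa using this.symm
    · have h1 : e ∉ A := by rw [hAt e hve, ht'']; simp
      exact hA' e hve h1 w' (by simp [h])
  · refine star_match_of_side hlf hlg hC hconn hv (p := fun w => !p w)
      (by rw [coboundary_not, hp]) fun e w w' h hw => ?_
    by_cases hve : v ∈ f e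
    · have := hcross e w w' h hve
      cases h1 : p w <;> cases h2 : p w' <;> simp_all
    · have h1 : e ∈ A := by rw [hAt e hve, ht'']
      have := h1.2 w (by simp [h])
      simp [this] at hw

/-- Matching stars to stars gives the vertex map, and an edge is determined by its two ends,
provided the map is injective. Two vertices with the same star occur only when all edges are
parallel. -/
theorem lIso_of_noVertexPairCut [Nonempty E] {f : E → Sym2 V} {g : E → Sym2 W} (hlf : Loopless f)
    (hlg : Loopless g) (hC : cutSpace f = cutSpace g) (hconn : Conn (cutSpace f))
    (h3 : NoVertexPairCut f) : LIso f g := by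
  classical
  have hW : Nonempty W := by
    obtain ⟨e⟩ := ‹Nonempty E›
    obtain ⟨a, _, _⟩ := exists_ends g e
    exact ⟨a⟩
  have hstar := fun v (hv : v ∈ verts f) => star_match hlf hlg hC hconn h3 hv
  choose! σ hσ using hstar
  by_cases hinj : InjOn σ (verts f)
  · refine ⟨σ, hinj, fun e => ?_⟩
    obtain ⟨a, b, hab⟩ := exists_ends f e
    have ha : a ∈ verts f := ⟨e, by simp [hab]⟩
    have hb : b ∈ verts f := ⟨e, by simp [hab]⟩
    rw [hab, Sym2.map_mk]
    refine (Sym2.mem_and_mem_iff fun h => hlf.ne hab (hinj ha hb h)).1 ⟨?_, ?_⟩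
    · rw [hσ a ha]; simp [hab]
    · rw [hσ b hb]; simp [hab]
  · simp only [InjOn, not_forall] at hinj
    obtain ⟨u, hu, v, hv, huv, hne⟩ := hinj
    have huv' : ∀ e, u ∈ f e ↔ v ∈ f e := fun e => by rw [← hσ u hu, ← hσ v hv, huv]
    -- The sum of the indicators of `u` and `v` has zero coboundary, hence is constant on the
    -- non-isolated vertices, so `u` and `v` are the only ones.
    have hmem : ∀ e, f e = s(u, v) := by
      obtain ⟨t, ht⟩ := hconn.const hlf (q := fun a => single u a ^^ single v a) fun e => by
        rw [coboundary_xor]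
        have h1 := coboundary_single hlf u e
        have h2 := coboundary_single hlf v e
        rw [← huv' e, ← h1] at h2
        cases h3 : coboundary f (single u) e <;> simp_all
      have htt : t = true := by
        rw [← ht u hu]
        simp [single, hne]
      intro e
      obtain ⟨a, b, hab⟩ := exists_ends f e
      have ha := ht a ⟨e, by simp [hab]⟩
      have hb := ht b ⟨e, by simp [hab]⟩
      have := hlf.ne hab
      rw [hab]
      simp only [single, htt] at ha hb
      grind
    have hall : ∀ {a e₀}, a ∈ g e₀ → ∀ e, a ∈ g e := by
      intro a e₀ ha e
      obtain ⟨r, hr⟩ : coboundary g (single a) ∈ cutSpace f := hC ▸ coboundary_mem g _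
      rw [← coboundary_single hlg, ← hr, coboundary_mk (hmem _)] at ha ⊢
      exact ha
    obtain ⟨e₀⟩ := ‹Nonempty E›
    obtain ⟨a, b, hab⟩ := exists_ends g e₀
    have hne' := hlg.ne hab
    have hverts : ∀ w ∈ verts f, w = u ∨ w = v := by
      rintro w ⟨e, he⟩
      rwa [hmem, Sym2.mem_iff] at he
    refine ⟨fun w => if w = u then a else b, ?_, fun e => ?_⟩
    · intro w hw w' hw' heq
      have := hverts w hw
      have := hverts w' hw'
      grind
    · rw [hmem e, Sym2.map_mk, if_pos rfl, if_neg (Ne.symm hne)]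
      exact (Sym2.mem_and_mem_iff hne').1
        ⟨hall (e₀ := e₀) (by simp [hab]) e, hall (e₀ := e₀) (by simp [hab]) e⟩

end Stars

/-! ### Reducing the attachments of a side by reversals. -/

section Ring

variable {E W : Type*}

/-- Modulo the sum of its parts on `S` and outside `S`, the space has at most one nonzero
element. -/
def AlmostSplits (C : Set (E → Bool)) (S : Set E) : Prop :=
  ∀ c ∈ C, ∀ d ∈ C, ¬ PartMem C S c → ¬ PartMem C S d → PartMem C S (fun e => c e ^^ d e)

/-- The part on `S` of the sum of the stars at `w` and `w'` is the coboundary of `q`. -/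
def PairPotential (g : E → Sym2 W) (S : Set E) (w w' : W) (q : W → Bool) : Prop :=
  (∀ e ∈ S, coboundary g q e = (coboundary g (single w) e ^^ coboundary g (single w') e)) ∧
    ∀ e ∉ S, coboundary g q e = false

/-- Neither star alone has a part on `S` that is a cut, as both vertices are attachments; almost
splitting therefore makes the part of their sum a cut. -/
theorem AlmostSplits.exists_pairPotential {g : E → Sym2 W} (hl : Loopless g)
    (hC : Conn (cutSpace g)) {S : Set E} (hS : AlmostSplits (cutSpace g) S) {w w' : W}
    (hw : w ∈ boundary g S) (hw' : w' ∈ boundary g S) : ∃ q, PairPotential g S w w' q := by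
  have h2 := fun (P : Set E) (z : W) (h : boundary g P ⊆ {z}) => hC.eq_empty_or_univ h
  obtain ⟨_, ⟨q, rfl⟩, h3, h4⟩ := hS _ (coboundary_mem g (single w)) _
    (coboundary_mem g (single w')) (not_partMem_single hl h2 hw) (not_partMem_single hl h2 hw')
  exact ⟨q, h3, h4⟩

theorem PairPotential.not {g : E → Sym2 W} {S : Set E} {w w' : W} {q : W → Bool}
    (h : PairPotential g S w w' q) : PairPotential g S w w' (fun u => !q u) := by
  rw [PairPotential, coboundary_not]
  exact h

theorem PairPotential.eq_off {g : E → Sym2 W} {S : Set E} {w w' : W} {q : W → Bool}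
    (hl : Loopless g) (h : PairPotential g S w w' q) {e : E} {u u' : W} (he : g e = s(u, u'))
    (h1 : w ∉ g e) (h2 : w' ∉ g e) : q u = q u' := by
  refine eq_of_coboundary_eq_false he ?_
  by_cases hS : e ∈ S
  · rw [h.1 e hS, coboundary_single_false hl h1, coboundary_single_false hl h2]
    rfl
  · exact h.2 e hS

theorem PairPotential.eq_of_notMem {g : E → Sym2 W} {S : Set E} {w w' : W} {q : W → Bool}
    (h : PairPotential g S w w' q) {e : E} {u u' : W} (he : g e = s(u, u'))
    (hS : e ∉ S) : q u = q u' :=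
  eq_of_coboundary_eq_false he (h.2 e hS)

theorem PairPotential.eq_pair {g : E → Sym2 W} {S : Set E} {w w' : W} {q : W → Bool}
    (hl : Loopless g) (h : PairPotential g S w w' q) {e : E} (he : g e = s(w, w')) :
    q w = q w' := by
  refine eq_of_coboundary_eq_false he ?_
  by_cases hS : e ∈ S
  · rw [h.1 e hS, (coboundary_single hl w e).2 (by simp [he]),
      (coboundary_single hl w' e).2 (by simp [he])]
    rfl
  · exact h.2 e hS

theorem PairPotential.ne_left {g : E → Sym2 W} {S : Set E} {w w' : W} {q : W → Bool}
    (hl : Loopless g) (h : PairPotential g S w w' q) {e : E} {u : W} (he : g e = s(w, u))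
    (hu : u ≠ w') (hww' : w ≠ w') (hS : e ∈ S) : q w ≠ q u := by
  have h1 := h.1 e hS
  rw [(coboundary_single hl w e).2 (by simp [he]),
    coboundary_single_false hl (v := w') (by rw [he, Sym2.mem_iff]; tauto), coboundary_mk he] at h1
  simpa using h1

theorem PairPotential.symm {g : E → Sym2 W} {S : Set E} {w w' : W} {q : W → Bool}
    (h : PairPotential g S w w' q) : PairPotential g S w' w q :=
  ⟨fun e he => by rw [h.1 e he, Bool.xor_comm], h.2⟩

/-- Removing the part on `S` from the sum of the two full stars leaves the part on the complement.
-/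
theorem PairPotential.compl {g : E → Sym2 W} {S : Set E} {w w' : W} {q : W → Bool}
    (h : PairPotential g S w w' q) :
    PairPotential g Sᶜ w w' (fun u => q u ^^ (single w u ^^ single w' u)) := by
  refine ⟨fun e he => ?_, fun e he => ?_⟩
  · rw [coboundary_xor, coboundary_xor, h.2 e he, Bool.false_xor]
  · rw [coboundary_xor, coboundary_xor, h.1 e (by simpa using he), Bool.xor_self]

open Classical in
/-- A reversal that makes two of the attachments of `S` interior. -/
theorem PairPotential.exists_reversal {g : E → Sym2 W} {S : Set E} {w w' : W} {q : W → Bool}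
    (hl : Loopless g) (h : PairPotential g S w w' q) (hw : w ∈ boundary g S)
    (hw' : w' ∈ boundary g S) (hq : q w ≠ q w') :
    ∃ g', Reversal g g' ∧ boundary g' S ⊂ boundary g S := by
  have hne : w ≠ w' := fun h => hq (by rw [h])
  -- Away from `w` and `w'` the potential `q` is constant along edges, so `P` has only these two
  -- attachments. At `w` it consists of the edges outside `S`, at `w'` of the edges in `S`.
  set P : Set E := {e | ∃ u ∈ g e, u ≠ w ∧ u ≠ w' ∧ q u = q w} with hP
  have hends : ∀ e u, g e = s(w, u) → u ≠ w ∧ u ≠ w' := by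
    intro e u he
    refine ⟨(hl.ne he).symm, ?_⟩
    rintro rfl
    exact hq (h.eq_pair hl he)
  have hends' : ∀ e u, g e = s(w', u) → u ≠ w' ∧ u ≠ w := by
    intro e u he
    refine ⟨(hl.ne he).symm, ?_⟩
    rintro rfl
    exact hq (h.eq_pair hl (he.trans Sym2.eq_swap))
  have hPw : ∀ e, w ∈ g e → (e ∈ P ↔ e ∉ S) := by
    intro e he
    obtain ⟨u, hu⟩ := exists_other he
    obtain ⟨h1, h2⟩ := hends e u hu
    have h3 : e ∈ P ↔ q u = q w := by
      constructor
      · rintro ⟨u', hu', h3, h4, h5⟩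
        rw [hu, Sym2.mem_iff] at hu'
        rcases hu' with rfl | rfl
        · exact (h3 rfl).elim
        · exact h5
      · intro h3
        exact ⟨u, by simp [hu], h1, h2, h3⟩
    rw [h3]
    by_cases hS : e ∈ S
    · have := h.ne_left hl hu h2 hne hS
      simp [hS, this.symm]
    · simp [hS, (h.eq_of_notMem hu hS).symm]
  have hPw' : ∀ e, w' ∈ g e → (e ∈ P ↔ e ∈ S) := by
    intro e he
    obtain ⟨u, hu⟩ := exists_other he
    obtain ⟨h1, h2⟩ := hends' e u hu
    have h3 : e ∈ P ↔ q u = q w := by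
      constructor
      · rintro ⟨u', hu', h3, h4, h5⟩
        rw [hu, Sym2.mem_iff] at hu'
        rcases hu' with rfl | rfl
        · exact (h4 rfl).elim
        · exact h5
      · intro h3
        exact ⟨u, by simp [hu], h2, h1, h3⟩
    rw [h3]
    by_cases hS : e ∈ S
    · have := h.symm.ne_left hl hu h2 hne.symm hS
      simp only [hS, iff_true]
      cases h5 : q u <;> cases h6 : q w <;> cases h7 : q w' <;> simp_all
    · have := h.eq_of_notMem hu hS
      simp only [hS, iff_false]
      rw [← this]
      exact hq.symm
  have hsub : boundary g P ⊆ {w, w'} := by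
    rintro v ⟨⟨e, ⟨u, hu, h1, h2, h3⟩, hv⟩, e', he', hv'⟩
    by_contra hvw
    simp only [mem_insert_iff, mem_singleton_iff, not_or] at hvw
    refine he' ⟨v, hv', hvw.1, hvw.2, ?_⟩
    obtain ⟨b, hb⟩ := exists_other hv
    rw [hb, Sym2.mem_iff] at hu
    rcases hu with rfl | rfl
    · exact h3
    · rw [h.eq_off hl hb, h3] <;> rw [hb, Sym2.mem_iff] <;> tauto
  have hwP : w ∈ boundary g P := by
    obtain ⟨⟨e, he, hve⟩, e', he', hve'⟩ := hw
    exact mem_boundary ((hPw e' hve').2 he') (fun h => (hPw e hve).1 h he) hve' hve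
  have hwP' : w' ∈ boundary g P := by
    obtain ⟨⟨e, he, hve⟩, e', he', hve'⟩ := hw'
    exact mem_boundary ((hPw' e hve).2 he) (fun h => he' ((hPw' e' hve').1 h)) hve hve'
  refine ⟨_, ⟨P, w, w', hne, hsub.antisymm (by simp [insert_subset_iff, hwP, hwP']), rfl⟩, ?_⟩
  -- After the interchange, every edge at `w` lies in `S`.
  have hwS : w ∉ boundary (swapOn g P w w') S := by
    rintro ⟨-, e, he, hwe⟩
    by_cases heP : e ∈ P
    · rw [swapOn_mem heP, mem_map_swap, Equiv.swap_apply_left] at hwe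
      exact he ((hPw' e hwe).1 heP)
    · rw [swapOn_notMem heP] at hwe
      exact heP ((hPw e hwe).2 he)
  have hother : ∀ v, v ≠ w → v ≠ w' → ∀ e, v ∈ swapOn g P w w' e → v ∈ g e := by
    intro v h1 h2 e he
    by_cases heP : e ∈ P
    · rwa [swapOn_mem heP, mem_map_swap, Equiv.swap_apply_of_ne_of_ne h1 h2] at he
    · rwa [swapOn_notMem heP] at he
  refine ⟨fun v hv => ?_, fun h => hwS (h hw)⟩
  by_cases h1 : v = w
  · exact h1 ▸ hw
  by_cases h2 : v = w'
  · exact h2 ▸ hw'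
  obtain ⟨⟨e, he, hve⟩, e', he', hve'⟩ := hv
  exact ⟨⟨e, he, hother v h1 h2 e hve⟩, e', he', hother v h1 h2 e' hve'⟩

/-- Three attachments of `S`: one of the pair potentials separates its pair. The potentials are
normalized to vanish on their pairs; the last hypothesis is the remaining symmetry breaking. -/
theorem false_of_three {g : E → Sym2 W} {S : Set E} (hl : Loopless g)
    (hC : Conn (cutSpace g)) {w₁ w₂ w₃ : W} (h1 : w₁ ∈ boundary g S)
    (h12 : w₁ ≠ w₂) (h13 : w₁ ≠ w₃) (h23 : w₂ ≠ w₃)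
    {q r : W → Bool} (hq : PairPotential g S w₁ w₂ q) (hr : PairPotential g S w₁ w₃ r)
    (hq1 : q w₁ = false) (hq2 : q w₂ = false) (hq3 : q w₃ = false)
    (hr1 : r w₁ = false) (hr2 : r w₂ = false) (hr3 : r w₃ = false) : False := by
  have h2 := fun (P : Set E) (z : W) (h : boundary g P ⊆ {z}) => hC.eq_empty_or_univ h
  -- The conjunction `q && r` forgets `w₂` and `w₃`: its coboundary is the part on `S` of the star
  -- at `w₁` alone.
  refine not_partMem_single hl h2 h1 ⟨_, coboundary_mem g fun u => q u && r u, ?_, ?_⟩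
  · intro e he
    by_cases h1e : w₁ ∈ g e
    · obtain ⟨u, hu⟩ := exists_other h1e
      have hu2 : u ≠ w₂ := by
        rintro rfl
        exact hr.ne_left hl hu h23 h13 he (hr1.trans hr2.symm)
      have hu3 : u ≠ w₃ := by
        rintro rfl
        exact hq.ne_left hl hu h23.symm h12 he (hq1.trans hq3.symm)
      have h3 := hq.ne_left hl hu hu2 h12 he
      have h4 := hr.ne_left hl hu hu3 h13 he
      rw [(coboundary_single hl _ e).2 h1e, coboundary_mk hu]
      cases h5 : q u <;> cases h6 : r u <;> simp_all
    · rw [coboundary_single_false hl h1e]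
      by_cases h2e : w₂ ∈ g e
      · obtain ⟨u, hu⟩ := exists_other h2e
        by_cases hu3 : u = w₃
        · subst hu3
          simp [coboundary_mk hu, hq2, hq3]
        · have : r w₂ = r u := hr.eq_off hl hu h1e (by rw [hu, Sym2.mem_iff]; tauto)
          simp [coboundary_mk hu, hq2, ← this, hr2]
      · by_cases h3e : w₃ ∈ g e
        · obtain ⟨u, hu⟩ := exists_other h3e
          have : q w₃ = q u := hq.eq_off hl hu h1e h2e
          simp [coboundary_mk hu, ← this, hq3]
        · obtain ⟨u, u', hu⟩ := exists_ends g e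
          rw [coboundary_mk hu, hq.eq_off hl hu h1e h2e, hr.eq_off hl hu h1e h3e]
          simp
  · intro e he
    obtain ⟨u, u', hu⟩ := exists_ends g e
    rw [coboundary_mk hu, hq.eq_of_notMem hu he, hr.eq_of_notMem hu he]
    simp

theorem PairPotential.exists_normalized {g : E → Sym2 W} {S : Set E} {w w' : W} {q : W → Bool}
    (h : PairPotential g S w w' q) (hq : q w = q w') :
    ∃ q, PairPotential g S w w' q ∧ q w = false ∧ q w' = false := by
  cases h1 : q w
  · exact ⟨q, h, h1, by rw [← hq, h1]⟩
  · exact ⟨_, h.not, by simp [h1], by simp [← hq, h1]⟩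

/-- If no reversal helps, each of the three pair potentials takes equal values on its pair and can
be normalized to vanish there. Their sum has zero coboundary, so its constant value fixes each
potential at the third attachment, and a product of two potentials gives a contradiction. -/
theorem exists_reversal_boundary_ssubset {g : E → Sym2 W} {S : Set E} (hl : Loopless g)
    (hC : Conn (cutSpace g)) (hS : AlmostSplits (cutSpace g) S)
    {w₁ w₂ w₃ : W} (h1 : w₁ ∈ boundary g S) (h2 : w₂ ∈ boundary g S) (h3 : w₃ ∈ boundary g S)
    (h12 : w₁ ≠ w₂) (h13 : w₁ ≠ w₃) (h23 : w₂ ≠ w₃) :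
    ∃ g', Reversal g g' ∧ boundary g' S ⊂ boundary g S := by
  by_contra hno
  have key : ∀ w w', w ∈ boundary g S → w' ∈ boundary g S →
      ∃ q, PairPotential g S w w' q ∧ q w = false ∧ q w' = false := by
    intro w w' hw hw'
    obtain ⟨q, hq⟩ := hS.exists_pairPotential hl hC hw hw'
    refine hq.exists_normalized ?_
    by_contra hne
    exact hno (hq.exists_reversal hl hw hw' hne)
  obtain ⟨q, hq, hq1, hq2⟩ := key _ _ h1 h2
  obtain ⟨r, hr, hr1, hr3⟩ := key _ _ h1 h3
  obtain ⟨s, hs, hs2, hs3⟩ := key _ _ h2 h3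
  obtain ⟨t, ht⟩ := hC.const hl (q := fun u => q u ^^ (r u ^^ s u)) fun e => by
    rw [coboundary_xor, coboundary_xor]
    by_cases he : e ∈ S
    · rw [hq.1 e he, hr.1 e he, hs.1 e he]
      generalize coboundary g (single w₁) e = x
      generalize coboundary g (single w₂) e = y
      generalize coboundary g (single w₃) e = z
      decide +revert
    · rw [hq.2 e he, hr.2 e he, hs.2 e he]
      rfl
  have hv : ∀ {w}, w ∈ boundary g S → w ∈ verts g := fun h => by
    obtain ⟨⟨e, -, he⟩, -⟩ := h
    exact ⟨e, he⟩
  have e1 := ht _ (hv h1)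
  have e2 := ht _ (hv h2)
  have e3 := ht _ (hv h3)
  simp only [hq1, hq2, hr1, hr3, hs2, hs3, Bool.false_xor, Bool.xor_false] at e1 e2 e3
  cases htt : t
  · rw [htt] at e1 e2 e3
    exact false_of_three hl hC h1 h12 h13 h23 hq hr hq1 hq2 e3 hr1 e2 hr3
  -- If the constant is `true`, passing to the complementary part and negating gives potentials that
  -- vanish at all three attachments again.
  · rw [htt] at e1 e2 e3
    refine false_of_three hl hC (S := Sᶜ) (by rwa [boundary_compl]) h12 h13 h23 hq.compl.not
      hr.compl.not ?_ ?_ ?_ ?_ ?_ ?_ <;> simp [single, *, Ne.symm]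


/-- If `C` almost splits along `S`, then reversals make `S` a side of a 2-separation. -/
theorem exists_reversals_ncard_boundary_le_two [Finite W] {g : E → Sym2 W} {S : Set E}
    (hl : Loopless g) (hC : Conn (cutSpace g)) (hS : AlmostSplits (cutSpace g) S) :
    ∃ g', ReflTransGen Reversal g g' ∧ (boundary g' S).ncard ≤ 2 := by
  induction hn : (boundary g S).ncard using Nat.strong_induction_on generalizing g with
  | _ n ih =>
    by_cases h2 : n ≤ 2
    · exact ⟨g, .refl, hn ▸ h2⟩
    · obtain ⟨w₁, w₂, w₃, h1, h2, h3, h12, h13, h23⟩ :=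
        (two_lt_ncard_iff).1 (show 2 < (boundary g S).ncard by omega)
      obtain ⟨g', hg', hlt⟩ := exists_reversal_boundary_ssubset hl hC hS h1 h2 h3 h12 h13 h23
      have hC' := hg'.cutSpace_eq
      obtain ⟨g'', h4, h5⟩ := ih _ (hn ▸ ncard_lt_ncard hlt) (hg'.loopless hl)
        (hC' ▸ hC) (hC' ▸ hS) rfl
      exact ⟨g'', .head hg' h4, h5⟩

end Ring

/-! ### Collapsing a side of a 2-separation, and Whitney's theorem in the connected case. -/

section Collapse

variable {E V W : Type*}

open Classical in
/-- Replace all edges outside `S` by edges between `x` and `y`. -/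
noncomputable def collapse (f : E → Sym2 V) (S : Set E) (x y : V) : E → Sym2 V :=
  fun e => if e ∈ S then f e else s(x, y)

theorem collapse_mem {f : E → Sym2 V} {S : Set E} {x y : V} {e : E} (h : e ∈ S) :
    collapse f S x y e = f e := by simp [collapse, h]

theorem collapse_notMem {f : E → Sym2 V} {S : Set E} {x y : V} {e : E} (h : e ∉ S) :
    collapse f S x y e = s(x, y) := by simp [collapse, h]

theorem Loopless.collapse {f : E → Sym2 V} (hl : Loopless f) {S : Set E} {x y : V} (h : x ≠ y) :
    Loopless (collapse f S x y) := by
  intro e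
  by_cases he : e ∈ S
  · rw [collapse_mem he]; exact hl e
  · rw [collapse_notMem he]; simpa using h

/-- The cuts of a collapsed graph, in terms of the cuts of the graph. -/
def collapseSpace (C : Set (E → Bool)) (S : Set E) : Set (E → Bool) :=
  {c | ∃ c' ∈ C, (∀ e ∈ S, c e = c' e) ∧ ∀ e ∉ S, (c e = false ↔ PartMem C S c')}

theorem partMem_of_eq {f : E → Sym2 V} {S : Set E} {x y : V} (hS : boundary f S ⊆ {x, y})
    {p : V → Bool} (hp : p x = p y) : PartMem (cutSpace f) S (coboundary f p) := by
  classical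
  refine ⟨_, coboundary_mem f fun u => if ∃ e ∈ S, u ∈ f e then p u ^^ p x else false, ?_, ?_⟩
  · intro e he
    obtain ⟨a, b, hab⟩ := exists_ends f e
    rw [coboundary_mk hab, coboundary_mk hab, if_pos ⟨e, he, by simp [hab]⟩,
      if_pos ⟨e, he, by simp [hab]⟩, xor_xor_cancel]
  · intro e he
    have key : ∀ a ∈ f e, (if ∃ e ∈ S, a ∈ f e then p a ^^ p x else false) = false := by
      intro a ha
      split_ifs with h'
      · have : a ∈ boundary f S := ⟨h', e, he, ha⟩
        rcases hS this with rfl | rfl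
        · simp
        · simp [hp]
      · rfl
    obtain ⟨a, b, hab⟩ := exists_ends f e
    rw [coboundary_mk hab, key a (by simp [hab]), key b (by simp [hab])]
    rfl

/-- The only obstruction to restricting a potential to `S` is whether it differs at `x` and `y`;
this obstruction is one bit, additive in the potential. -/
theorem almostSplits_of_boundary {f : E → Sym2 V} {S : Set E} {x y : V}
    (hS : boundary f S ⊆ {x, y}) : AlmostSplits (cutSpace f) S := by
  rintro _ ⟨p, rfl⟩ _ ⟨q, rfl⟩ hp hq
  have h1 : p x ≠ p y := fun h => hp (partMem_of_eq hS h)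
  have h2 : q x ≠ q y := fun h => hq (partMem_of_eq hS h)
  have := partMem_of_eq (f := f) hS (p := fun v => p v ^^ q v) (by
    show (p x ^^ q x) = (p y ^^ q y)
    cases h3 : p x <;> cases h4 : p y <;> cases h5 : q x <;> cases h6 : q y <;> simp_all)
  convert this using 1
  exact funext fun e => (coboundary_xor f p q e).symm

/-- If one cut with different values at `x` and `y` could be restricted to `S`, adding it would
allow every cut to be restricted, and the space would split. -/
theorem partMem_iff {f : E → Sym2 V} (hC : Conn (cutSpace f)) {S : Set E} {x y : V}
    (hS : boundary f S = {x, y}) (p : V → Bool) :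
    PartMem (cutSpace f) S (coboundary f p) ↔ p x = p y := by
  refine ⟨fun h => ?_, partMem_of_eq hS.subset⟩
  by_contra hne
  have hsplit : Splits (cutSpace f) S := by
    rintro _ ⟨r, rfl⟩
    by_cases hr : r x = r y
    · exact partMem_of_eq hS.subset hr
    · have h1 := partMem_of_eq (f := f) hS.subset (p := fun v => r v ^^ p v) (by
        show (r x ^^ p x) = (r y ^^ p y)
        cases h3 : p x <;> cases h4 : p y <;> cases h5 : r x <;> cases h6 : r y <;> simp_all)
      convert h1.xor h using 1
      funext e
      rw [coboundary_xor]
      simp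
  have hx : x ∈ boundary f S := by simp [hS]
  obtain ⟨⟨e, he, -⟩, e', he', -⟩ := hx
  rcases hC S hsplit with rfl | rfl
  · exact he
  · exact he' (mem_univ _)

/-- The value on the collapsed edges is the obstruction bit, which is visible in the cut space.
Hence collapses of two graphs with the same cut space agree, although their cut pairs may be
unrelated. -/
theorem cutSpace_collapse {f : E → Sym2 V} (hC : Conn (cutSpace f)) {S : Set E} {x y : V}
    (hS : boundary f S = {x, y}) :
    cutSpace (collapse f S x y) = collapseSpace (cutSpace f) S := by
  have key : ∀ p : V → Bool, (∀ e ∈ S, coboundary (collapse f S x y) p e = coboundary f p e) ∧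
      ∀ e ∉ S, (coboundary (collapse f S x y) p e = false ↔
        PartMem (cutSpace f) S (coboundary f p)) := by
    intro p
    refine ⟨fun e he => ?_, fun e he => ?_⟩
    · obtain ⟨a, b, hab⟩ := exists_ends f e
      rw [coboundary_mk hab, coboundary_mk (a := a) (b := b) (by rw [collapse_mem he, hab])]
    · rw [partMem_iff hC hS, coboundary_mk (collapse_notMem he)]
      simp
  ext c
  constructor
  · rintro ⟨p, rfl⟩
    exact ⟨_, coboundary_mem f p, (key p).1, (key p).2⟩
  · rintro ⟨_, ⟨p, rfl⟩, h1, h2⟩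
    refine ⟨p, funext fun e => ?_⟩
    by_cases he : e ∈ S
    · rw [(key p).1 e he, h1 e he]
    · have := ((key p).2 e he).trans (h2 e he).symm
      rw [Bool.eq_iff_iff, ← not_iff_not, Bool.not_eq_true, Bool.not_eq_true]
      exact this

theorem boundary_subset_boundary_collapse {f : E → Sym2 V} {S P : Set E} {x y : V}
    (hS : boundary f S = {x, y}) (hP : P ⊆ S) :
    boundary f P ⊆ boundary (collapse f S x y) P := by
  rintro v ⟨⟨e, he, hv⟩, e', he', hv'⟩
  refine ⟨⟨e, he, by rwa [collapse_mem (hP he)]⟩, e', he', ?_⟩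
  by_cases h : e' ∈ S
  · rwa [collapse_mem h]
  · rw [collapse_notMem h, Sym2.mem_iff]
    have : v ∈ boundary f S := mem_boundary (hP he) h hv hv'
    rw [hS] at this
    simpa using this

/-- The edges outside `S` are all parallel with ends `x` and `y`; if both `P` and its complement
contain one, `x` and `y` are attachments of `P`. -/
theorem subset_or_subset_compl {f : E → Sym2 V} {S P : Set E} {x y : V}
    (h : ¬ {x, y} ⊆ boundary (collapse f S x y) P) : P ⊆ S ∨ Pᶜ ⊆ S := by
  by_contra hno
  rw [not_or, not_subset, not_subset] at hno
  obtain ⟨⟨e, he, heS⟩, e', he', heS'⟩ := hno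
  refine h ?_
  rintro v hv
  have hv' : v ∈ s(x, y) := by simpa using hv
  exact mem_boundary he he' (by rwa [collapse_notMem heS]) (by rwa [collapse_notMem heS'])

theorem Conn.collapse {f : E → Sym2 V} (hl : Loopless f) (hC : Conn (cutSpace f)) {S : Set E}
    {x y : V} (hxy : x ≠ y) (hS : boundary f S = {x, y}) :
    Conn (cutSpace (collapse f S x y)) := by
  refine conn_of_boundary (hl.collapse hxy) fun P z hP => ?_
  rcases subset_or_subset_compl (f := f) (S := S) (P := P) (x := x) (y := y) (fun h => by
    have h1 := (h.trans hP) (mem_insert x _)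
    have h2 := (h.trans hP) (mem_insert_of_mem x rfl)
    exact hxy (h1.trans h2.symm)) with h | h
  · exact hC.eq_empty_or_univ ((boundary_subset_boundary_collapse hS h).trans hP)
  · have := hC.eq_empty_or_univ (P := Pᶜ) (z := z)
      ((boundary_subset_boundary_collapse hS h).trans (by rwa [boundary_compl]))
    rw [compl_empty_iff, compl_univ_iff] at this
    exact this.symm

theorem verts_collapse {f : E → Sym2 V} {S : Set E} {x y : V} (hS : boundary f S = {x, y}) :
    verts (collapse f S x y) = {v | ∃ e ∈ S, v ∈ f e} := by
  ext v
  constructor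
  · rintro ⟨e, he⟩
    by_cases h : e ∈ S
    · exact ⟨e, h, by rwa [collapse_mem h] at he⟩
    · rw [collapse_notMem h] at he
      have : v ∈ boundary f S := by rw [hS]; simpa using he
      exact this.1
  · rintro ⟨e, he, hv⟩
    exact ⟨e, by rwa [collapse_mem he]⟩

theorem Conn.boundary_eq_pair {f : E → Sym2 V} (hC : Conn (cutSpace f)) {P : Set E} {x y : V}
    (hP : boundary f P ⊆ {x, y}) (h0 : P ≠ ∅) (h1 : P ≠ univ) : boundary f P = {x, y} := by
  refine hP.antisymm ?_
  have key : ∀ x y, boundary f P ⊆ {x, y} → x ∈ boundary f P := by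
    intro x y hP
    by_contra hx
    have : boundary f P ⊆ {y} := fun v hv => by
      rcases hP hv with rfl | h
      · exact (hx hv).elim
      · exact h
    rcases hC.eq_empty_or_univ this with h | h
    · exact h0 h
    · exact h1 h
  rintro v (rfl | hv)
  · exact key _ _ hP
  · rw [mem_singleton_iff.1 hv]
    exact key y x (by rwa [pair_comm])

/-- A 2-separation carried along by a reversal. -/
structure Lift (f : E → Sym2 V) (S : Set E) (x y : V) (f' : E → Sym2 V) (x' y' : V) : Prop where
  reversals : ReflTransGen Reversal f f'
  ne : x' ≠ y'
  boundary : boundary f' S = {x', y'}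
  iso : ∃ ρ : Equiv.Perm V, ∀ e, collapse f' Sᶜ x' y' e = (collapse f Sᶜ x y e).map ρ

-- A reversal inside `S` leaves the other side untouched, and the cut pair stays in place.
open Classical in
theorem exists_lift_of_subset {f : E → Sym2 V} {S P : Set E} {x y a b : V}
    (hxy : x ≠ y) (hS : boundary f S = {x, y}) (hab : a ≠ b) (hP : boundary f P = {a, b})
    (hPS : P ⊆ S) :
    ∃ f', Lift f S x y f' x y ∧ swapOn (collapse f S x y) P a b = collapse f' S x y := by
  have hoff : ∀ e ∉ S, swapOn f P a b e = f e := fun e he => swapOn_notMem fun h => he (hPS h)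
  refine ⟨swapOn f P a b, ⟨.single ⟨P, a, b, hab, hP, rfl⟩, hxy, ?_, 1, fun e => ?_⟩, ?_⟩
  · rw [← hS]
    have ha : a ∈ boundary f P := by simp [hP]
    have hb : b ∈ boundary f P := by simp [hP]
    ext v
    refine and_congr ?_ (exists_congr fun e => and_congr_right fun he => by rw [hoff e he])
    have key : ∀ g : E → Sym2 V, (∃ e ∈ S, v ∈ g e) ↔
        (∃ e ∈ P, v ∈ g e) ∨ ∃ e ∈ S \ P, v ∈ g e := by
      intro g
      constructor
      · rintro ⟨e, he, hv⟩
        by_cases h : e ∈ P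
        · exact .inl ⟨e, h, hv⟩
        · exact .inr ⟨e, ⟨he, h⟩, hv⟩
      · rintro (⟨e, he, hv⟩ | ⟨e, he, hv⟩)
        · exact ⟨e, hPS he, hv⟩
        · exact ⟨e, he.1, hv⟩
    rw [key, key, exists_mem_swapOn ha hb]
    refine or_congr_right (exists_congr fun e => and_congr_right fun he => ?_)
    rw [swapOn_notMem he.2]
  · by_cases he : e ∈ S
    · rw [collapse_notMem (by simpa using he), collapse_notMem (by simpa using he)]
      simp
    · rw [collapse_mem (by simpa using he), collapse_mem (by simpa using he), hoff e he]
      simp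
  · funext e
    by_cases he : e ∈ S
    · rw [collapse_mem he]
      by_cases heP : e ∈ P
      · rw [swapOn_mem heP, swapOn_mem heP, collapse_mem he]
      · rw [swapOn_notMem heP, swapOn_notMem heP, collapse_mem he]
    · rw [swapOn_notMem fun h => he (hPS h), collapse_notMem he, collapse_notMem he]

-- Here the whole side outside `S` is moved by the transposition of `a` and `b`. It changes only by
-- a permutation of the vertices, but the cut pair moves along.
open Classical in
theorem exists_lift_of_compl_subset {f : E → Sym2 V} {S P : Set E} {x y a b : V}
    (hxy : x ≠ y) (hS : boundary f S = {x, y}) (hab : a ≠ b) (hP : boundary f P = {a, b})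
    (hPS : Pᶜ ⊆ S) :
    ∃ f' x' y', Lift f S x y f' x' y' ∧
      swapOn (collapse f S x y) P a b = collapse f' S x' y' := by
  have hoff : ∀ e ∉ S, e ∈ P := fun e he => by
    by_contra h
    exact he (hPS h)
  have ha : a ∈ boundary f P := by simp [hP]
  have hb : b ∈ boundary f P := by simp [hP]
  have hswap : ∀ v, (∃ e ∈ S, v ∈ f e) ↔ ∃ e ∈ S, Equiv.swap a b v ∈ f e := by
    have haS : ∃ e ∈ S, a ∈ f e := by
      obtain ⟨-, e, he, h⟩ := ha
      exact ⟨e, hPS he, h⟩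
    have hbS : ∃ e ∈ S, b ∈ f e := by
      obtain ⟨-, e, he, h⟩ := hb
      exact ⟨e, hPS he, h⟩
    intro v
    by_cases hva : v = a
    · subst hva
      simp [haS, hbS]
    · by_cases hvb : v = b
      · subst hvb
        simp [haS, hbS]
      · rw [Equiv.swap_apply_of_ne_of_ne hva hvb]
  refine ⟨swapOn f P a b, Equiv.swap a b x, Equiv.swap a b y,
    ⟨.single ⟨P, a, b, hab, hP, rfl⟩, by simpa using hxy, ?_, Equiv.swap a b, fun e => ?_⟩, ?_⟩
  · ext v
    have h1 : v ∈ boundary (swapOn f P a b) S ↔ Equiv.swap a b v ∈ boundary f S := by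
      refine and_congr ?_ (exists_congr fun e => and_congr_right fun he => by
        rw [swapOn_mem (hoff e he), mem_map_swap])
      rw [← hswap]
      have key : ∀ g : E → Sym2 V, (∃ e ∈ S, v ∈ g e) ↔
          (∃ e ∈ S ∩ P, v ∈ g e) ∨ ∃ e ∈ Pᶜ, v ∈ g e := by
        intro g
        constructor
        · rintro ⟨e, he, hv⟩
          by_cases h : e ∈ P
          · exact .inl ⟨e, ⟨he, h⟩, hv⟩
          · exact .inr ⟨e, h, hv⟩
        · rintro (⟨e, he, hv⟩ | ⟨e, he, hv⟩)
          · exact ⟨e, he.1, hv⟩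
          · exact ⟨e, hPS he, hv⟩
      have h2 : (∃ e ∈ Pᶜ, v ∈ swapOn f P a b e) ↔ ∃ e ∈ Pᶜ, v ∈ f e :=
        exists_notMem_swapOn v
      have hne : v ≠ a → v ≠ b → ((∃ e ∈ S, v ∈ swapOn f P a b e) ↔ ∃ e ∈ S, v ∈ f e) := by
        intro h3 h4
        refine exists_congr fun e => and_congr_right fun he => ?_
        by_cases h : e ∈ P
        · rw [swapOn_mem h, mem_map_swap, Equiv.swap_apply_of_ne_of_ne h3 h4]
        · rw [swapOn_notMem h]
      by_cases h3 : v = a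
      · subst h3
        exact iff_of_true ((key _).2 (.inr (h2.2 ha.2))) ((key _).2 (.inr ha.2))
      by_cases h4 : v = b
      · subst h4
        exact iff_of_true ((key _).2 (.inr (h2.2 hb.2))) ((key _).2 (.inr hb.2))
      exact hne h3 h4
    rw [h1, hS, mem_insert_iff, mem_singleton_iff, mem_insert_iff, mem_singleton_iff,
      Equiv.swap_apply_eq_iff, Equiv.swap_apply_eq_iff]
  · by_cases he : e ∈ S
    · rw [collapse_notMem (by simpa using he), collapse_notMem (by simpa using he), Sym2.map_mk]
    · rw [collapse_mem (by simpa using he), collapse_mem (by simpa using he),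
        swapOn_mem (hoff e he)]
  · funext e
    by_cases he : e ∈ S
    · rw [collapse_mem he]
      by_cases heP : e ∈ P
      · rw [swapOn_mem heP, swapOn_mem heP, collapse_mem he]
      · rw [swapOn_notMem heP, swapOn_notMem heP, collapse_mem he]
    · rw [swapOn_mem (hoff e he), collapse_notMem he, collapse_notMem he, Sym2.map_mk]

theorem Lift.refl {f : E → Sym2 V} {S : Set E} {x y : V} (hxy : x ≠ y)
    (hS : MeasIso.boundary f S = {x, y}) : Lift f S x y f x y :=
  ⟨.refl, hxy, hS, 1, fun e => by simp⟩

theorem Lift.trans {f f' f'' : E → Sym2 V} {S : Set E} {x y x' y' x'' y'' : V}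
    (h : Lift f S x y f' x' y') (h' : Lift f' S x' y' f'' x'' y'') : Lift f S x y f'' x'' y'' := by
  obtain ⟨ρ, hρ⟩ := h.iso
  obtain ⟨τ, hτ⟩ := h'.iso
  refine ⟨h.reversals.trans h'.reversals, h'.ne, h'.boundary, ρ.trans τ, fun e => ?_⟩
  rw [hτ, hρ, Sym2.map_map]
  rfl

open Classical in
/-- A reversal of a collapsed graph lifts to the graph. -/
theorem exists_lift {f : E → Sym2 V} (hC : Conn (cutSpace f)) {S : Set E} {x y : V}
    (hxy : x ≠ y) (hS : boundary f S = {x, y}) {h : E → Sym2 V}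
    (hh : Reversal (collapse f S x y) h) :
    ∃ f' x' y', Lift f S x y f' x' y' ∧ h = collapse f' S x' y' := by
  obtain ⟨P, a, b, hab, hP, rfl⟩ := hh
  have hx : x ∈ boundary f S := by simp [hS]
  have haP : a ∈ boundary (collapse f S x y) P := by simp [hP]
  obtain ⟨⟨e₁, he₁, -⟩, e₂, he₂, -⟩ := haP
  by_cases hPS' : Pᶜ ⊆ S
  · refine exists_lift_of_compl_subset hxy hS hab ?_ hPS'
    rw [← boundary_compl]
    refine hC.boundary_eq_pair ?_ (nonempty_of_mem (show e₂ ∈ Pᶜ from he₂)).ne_empty (fun h => ?_)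
    · rw [← hP, ← boundary_compl _ P]
      exact boundary_subset_boundary_collapse hS hPS'
    · exact (h ▸ mem_univ e₁ : e₁ ∈ Pᶜ) he₁
  · -- the edges outside `S` can be removed from `P`
    -- If `P` contains some but not all of the collapsed edges, its attachments are exactly `x` and
    -- `y`, and interchanging these fixes every collapsed edge.
    have hswap : swapOn (collapse f S x y) P a b = swapOn (collapse f S x y) (P ∩ S) a b := by
      funext e
      by_cases heS : e ∈ S
      · by_cases heP : e ∈ P
        · rw [swapOn_mem heP, swapOn_mem (P := P ∩ S) ⟨heP, heS⟩]
        · rw [swapOn_notMem heP, swapOn_notMem fun h => heP h.1]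
      · rw [swapOn_notMem (P := P ∩ S) fun h => heS h.2]
        by_cases heP : e ∈ P
        · rw [swapOn_mem heP, collapse_notMem heS, Sym2.map_mk]
          have hsub : {x, y} ⊆ boundary (collapse f S x y) P := by
            by_contra hno
            rcases subset_or_subset_compl hno with h | h
            · exact heS (h heP)
            · exact hPS' h
          rw [hP] at hsub
          have h1 := hsub (mem_insert x _)
          have h2 := hsub (mem_insert_of_mem x rfl)
          simp only [mem_insert_iff, mem_singleton_iff] at h1 h2
          rcases h1 with rfl | rfl <;> rcases h2 with rfl | rfl
          · exact (hxy rfl).elim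
          · simp [Sym2.eq_swap]
          · simp [Sym2.eq_swap]
          · exact (hxy rfl).elim
        · rw [swapOn_notMem heP]
    rw [hswap]
    by_cases h0 : P ∩ S = ∅
    · refine ⟨f, x, y, .refl hxy hS, ?_⟩
      rw [h0]
      exact funext fun e => swapOn_notMem (by simp)
    obtain ⟨f', h1, h2⟩ := exists_lift_of_subset hxy hS hab (P := P ∩ S) (hC.boundary_eq_pair (by
      refine (boundary_subset_boundary_collapse hS inter_subset_right).trans ?_
      rw [← hP]
      rintro v ⟨⟨e, he, hv⟩, e', he', hv'⟩
      by_cases heP' : e' ∈ P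
      · have heS' : e' ∉ S := fun h => he' ⟨heP', h⟩
        obtain ⟨e'', he'', heS''⟩ := not_subset.1 hPS'
        refine mem_boundary he.1 he'' hv ?_
        rw [collapse_notMem heS'] at hv'
        rwa [collapse_notMem heS'']
      · exact mem_boundary he.1 heP' hv hv') h0 (fun h => by
        obtain ⟨-, e, he, -⟩ := hx
        exact he ((h ▸ mem_univ e : e ∈ P ∩ S).2))) inter_subset_right
    exact ⟨f', x, y, h1, h2⟩

theorem exists_lift_reversals {f : E → Sym2 V} (hC : Conn (cutSpace f)) {S : Set E} {x y : V}
    (hxy : x ≠ y) (hS : boundary f S = {x, y}) {h : E → Sym2 V}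
    (hh : ReflTransGen Reversal (collapse f S x y) h) :
    ∃ f' x' y', Lift f S x y f' x' y' ∧ h = collapse f' S x' y' := by
  induction hh with
  | refl => exact ⟨f, x, y, .refl hxy hS, rfl⟩
  | tail _ h ih =>
    obtain ⟨f', x', y', h1, rfl⟩ := ih
    obtain ⟨f'', x'', y'', h2, rfl⟩ := exists_lift
      (cutSpace_eq_of_reversals h1.reversals ▸ hC) h1.ne h1.boundary h
    exact ⟨f'', x'', y'', h1.trans h2, rfl⟩

/-- Two graphs with isomorphic sides are isomorphic, if the isomorphisms agree on the common
vertices of the sides. -/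
theorem lIso_of_sides {f : E → Sym2 V} {g : E → Sym2 W} {S : Set E} {x y : V} {x' y' : W}
    (hS : boundary f S = {x, y}) (hS' : boundary g S = {x', y'}) {α β : V → W}
    (hα : InjOn α (verts (collapse f S x y)))
    (hα' : ∀ e, collapse g S x' y' e = (collapse f S x y e).map α)
    (hβ : InjOn β (verts (collapse f Sᶜ x y)))
    (hβ' : ∀ e, collapse g Sᶜ x' y' e = (collapse f Sᶜ x y e).map β)
    (hx : α x = β x) (hy : α y = β y) : LIso f g := by
  classical
  rw [verts_collapse hS] at hα
  rw [verts_collapse (by rwa [boundary_compl])] at hβ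
  have hαS : ∀ e ∈ S, g e = (f e).map α := fun e he => by
    have := hα' e
    rwa [collapse_mem he, collapse_mem he] at this
  have hβS : ∀ e ∉ S, g e = (f e).map β := fun e he => by
    have := hβ' e
    rwa [collapse_mem (by simpa using he), collapse_mem (by simpa using he)] at this
  set σ : V → W := fun v => if ∃ e ∈ S, v ∈ f e then α v else β v with hσ
  have hσα : ∀ v, (∃ e ∈ S, v ∈ f e) → σ v = α v := fun v hv => by simp only [hσ, if_pos hv]
  have hσβ : ∀ v, (∃ e ∉ S, v ∈ f e) → σ v = β v := fun v hv => by
    by_cases h : ∃ e ∈ S, v ∈ f e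
    · have : v ∈ boundary f S := ⟨h, hv⟩
      rw [hS] at this
      rw [hσα v h]
      rcases this with rfl | rfl
      · exact hx
      · exact hy
    · simp only [hσ, if_neg h]
  -- Only a boundary vertex of `g` can be hit from both sides. The images of the collapsed edges
  -- show that such a vertex comes from `x` or `y`.
  have hcross : ∀ u v, (∃ e ∈ S, u ∈ f e) → (∃ e ∉ S, v ∈ f e) → σ u = σ v → u = v := by
    intro u v hu hv huv
    rw [hσα u hu, hσβ v hv] at huv
    have hmem : β v ∈ boundary g S := by
      obtain ⟨e, he, hue⟩ := hu
      obtain ⟨e', he', hve⟩ := hv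
      refine mem_boundary he he' ?_ ?_
      · rw [hαS e he, ← huv]
        exact Sym2.mem_map.2 ⟨u, hue, rfl⟩
      · rw [hβS e' he']
        exact Sym2.mem_map.2 ⟨v, hve, rfl⟩
    have hvS : v ∈ boundary f S := by
      obtain ⟨e, he, hue⟩ := hu
      have h2 := hβ' e
      rw [collapse_notMem (by simpa using he), collapse_notMem (by simpa using he),
        Sym2.map_mk] at h2
      have h3 : β v ∈ s(x', y') := by
        rw [hS'] at hmem
        simpa using hmem
      rw [h2, Sym2.mem_iff] at h3
      have hx2 : x ∈ boundary f S := by simp [hS]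
      have hy2 : y ∈ boundary f S := by simp [hS]
      rcases h3 with h3 | h3
      · rw [hβ hv hx2.2 h3]; exact hx2
      · rw [hβ hv hy2.2 h3]; exact hy2
    refine hα hu hvS.1 ?_
    rw [huv, ← hσβ v hv, hσα v hvS.1]
  refine ⟨σ, ?_, fun e => ?_⟩
  · rintro u ⟨e, hu⟩ v ⟨e', hv⟩ huv
    by_cases he : e ∈ S <;> by_cases he' : e' ∈ S
    · rw [hσα u ⟨e, he, hu⟩, hσα v ⟨e', he', hv⟩] at huv
      exact hα ⟨e, he, hu⟩ ⟨e', he', hv⟩ huv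
    · exact hcross u v ⟨e, he, hu⟩ ⟨e', he', hv⟩ huv
    · exact (hcross v u ⟨e', he', hv⟩ ⟨e, he, hu⟩ huv.symm).symm
    · rw [hσβ u ⟨e, he, hu⟩, hσβ v ⟨e', he', hv⟩] at huv
      exact hβ ⟨e, he, hu⟩ ⟨e', he', hv⟩ huv
  · by_cases he : e ∈ S
    · rw [hαS e he]
      exact sym2_map_congr fun v hv => (hσα v ⟨e, he, hv⟩).symm
    · rw [hβS e he]
      exact sym2_map_congr fun v hv => (hσβ v ⟨e, he, hv⟩).symm

open Classical in
/-- Two graphs with isomorphic sides are isomorphic after at most one reversal. -/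
theorem exists_reversals_lIso_of_sides {f : E → Sym2 V} {g : E → Sym2 W} {S : Set E} {x y : V}
    {x' y' : W} (hxy : x ≠ y) (hS : boundary f S = {x, y}) (hS' : boundary g S = {x', y'})
    (h : LIso (collapse f S x y) (collapse g S x' y'))
    (h' : LIso (collapse f Sᶜ x y) (collapse g Sᶜ x' y')) :
    ∃ f', ReflTransGen Reversal f f' ∧ LIso f' g := by
  obtain ⟨α, hα, hα'⟩ := h
  obtain ⟨β, hβ, hβ'⟩ := h'
  have hx : x ∈ boundary f S := by simp [hS]
  have hy : y ∈ boundary f S := by simp [hS]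
  obtain ⟨⟨e₁, he₁, -⟩, e₂, he₂, -⟩ := id hx
  have h1 := hα' e₂
  rw [collapse_notMem he₂, collapse_notMem he₂, Sym2.map_mk] at h1
  have h2 := hβ' e₁
  rw [collapse_notMem (by simpa using he₁), collapse_notMem (by simpa using he₁), Sym2.map_mk,
    h1, Sym2.eq_iff] at h2
  rcases h2 with ⟨h2, h3⟩ | ⟨h2, h3⟩
  · exact ⟨f, .refl, lIso_of_sides hS hS' hα hα' hβ hβ' h2 h3⟩
  -- The two isomorphisms match the cut pairs in opposite orders; reversing `S` repairs this.
  · have hS2 : boundary (swapOn f S x y) S = {x, y} := by rw [boundary_swapOn hx hy, hS]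
    refine ⟨swapOn f S x y, .single ⟨S, x, y, hxy, hS, rfl⟩,
      lIso_of_sides (α := α ∘ Equiv.swap x y) hS2 hS' ?_ ?_ (β := β) ?_ ?_ (by simpa using h3)
        (by simpa using h2)⟩
    · rw [verts_collapse hS2]
      rw [verts_collapse hS] at hα
      refine hα.comp (Equiv.injective _).injOn ?_
      rintro v ⟨e, he, hv⟩
      rw [swapOn_mem he, mem_map_swap] at hv
      exact ⟨e, he, hv⟩
    · intro e
      rw [hα']
      by_cases he : e ∈ S
      · rw [collapse_mem he, collapse_mem he, swapOn_mem he, Sym2.map_map]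
        exact sym2_map_congr fun v _ => by simp
      · rw [collapse_notMem he, collapse_notMem he]
        simp [Sym2.eq_swap]
    · have : collapse (swapOn f S x y) Sᶜ x y = collapse f Sᶜ x y := by
        funext e
        by_cases he : e ∈ S
        · rw [collapse_notMem (by simpa using he), collapse_notMem (by simpa using he)]
        · rw [collapse_mem (by simpa using he), collapse_mem (by simpa using he),
            swapOn_notMem he]
      rwa [this]
    · intro e
      rw [hβ']
      by_cases he : e ∈ S
      · rw [collapse_notMem (by simpa using he), collapse_notMem (by simpa using he)]
      · rw [collapse_mem (by simpa using he), collapse_mem (by simpa using he),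
          swapOn_notMem he]

/-- The side `S` is cut out by a potential that is not constant away from `x` and `y`. The vertices
`a` and `b`, each missing from one side, make both collapsed graphs smaller. -/
theorem exists_separation {f : E → Sym2 V} (hC : Conn (cutSpace f))
    (h3 : ¬ NoVertexPairCut f) : ∃ (S : Set E) (x y a b : V), x ≠ y ∧ boundary f S = {x, y} ∧
      a ∈ verts f ∧ (∀ e ∉ S, a ∉ f e) ∧ b ∈ verts f ∧ ∀ e ∈ S, b ∉ f e := by
  simp only [NoVertexPairCut, not_forall] at h3
  obtain ⟨x, y, q, hq, hno⟩ := h3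
  have hxy : x ≠ y := by
    rintro rfl
    obtain ⟨t, ht⟩ := hC.const_off x fun e he => hq e he he
    exact hno ⟨t, fun u hu h _ => ht u hu h⟩
  obtain ⟨a, ha, hax, hay, hqa⟩ : ∃ a ∈ verts f, a ≠ x ∧ a ≠ y ∧ q a = true := by
    by_contra h
    refine hno ⟨false, fun u hu h1 h2 => ?_⟩
    by_contra h3
    exact h ⟨u, hu, h1, h2, by simpa using h3⟩
  obtain ⟨b, hb, hbx, hby, hqb⟩ : ∃ a ∈ verts f, a ≠ x ∧ a ≠ y ∧ q a = false := by
    by_contra h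
    refine hno ⟨true, fun u hu h1 h2 => ?_⟩
    by_contra h3
    exact h ⟨u, hu, h1, h2, by simpa using h3⟩
  have key : ∀ e u v, u ∈ f e → v ∈ f e → u ≠ x → u ≠ y → v ≠ x → v ≠ y → q u = q v := by
    intro e u v hu hv h1 h2 h3 h4
    obtain ⟨w, hw⟩ := exists_other hu
    rw [hw, Sym2.mem_iff] at hv
    rcases hv with rfl | rfl
    · rfl
    · refine eq_of_coboundary_eq_false hw (hq e ?_ ?_) <;> rw [hw, Sym2.mem_iff] <;> tauto
  set S : Set E := {e | ∃ u ∈ f e, u ≠ x ∧ u ≠ y ∧ q u = true} with hS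
  have haS : ∀ e ∉ S, a ∉ f e := fun e he h => he ⟨a, h, hax, hay, hqa⟩
  have hbS : ∀ e ∈ S, b ∉ f e := by
    rintro e ⟨u, hu, h1, h2, h3⟩ h
    have := key e b u h hu hbx hby h1 h2
    simp [hqb, h3] at this
  refine ⟨S, x, y, a, b, hxy, hC.boundary_eq_pair ?_ ?_ ?_, ha, haS, hb, hbS⟩
  · rintro v ⟨⟨e, ⟨u, hu, h1, h2, h3⟩, hv⟩, e', he', hv'⟩
    by_contra hno
    simp only [mem_insert_iff, mem_singleton_iff, not_or] at hno
    exact he' ⟨v, hv', hno.1, hno.2, (key e v u hv hu hno.1 hno.2 h1 h2).trans h3⟩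
  · rintro h
    obtain ⟨e, he⟩ := ha
    exact haS e (by simp [h]) he
  · rintro h
    obtain ⟨e, he⟩ := hb
    exact hbS e (by simp [h]) he

theorem Conn.exists_boundary_eq_pair [Finite V] {f : E → Sym2 V} (hC : Conn (cutSpace f))
    {S : Set E} (h0 : S ≠ ∅) (h1 : S ≠ univ) (h : (boundary f S).ncard ≤ 2) :
    ∃ x y, x ≠ y ∧ boundary f S = {x, y} := by
  have h2 : (boundary f S).ncard = 2 := by
    by_contra h2
    have h3 : (boundary f S).ncard ≤ 1 := by omega
    obtain ⟨e, he⟩ := nonempty_iff_ne_empty.2 h0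
    obtain ⟨a, _, _⟩ := exists_ends f e
    obtain ⟨z, hz⟩ : ∃ z, boundary f S ⊆ {z} := by
      rcases (ncard_le_one_iff_eq).1 h3 with h | ⟨z, hz⟩
      · exact ⟨a, by simp [h]⟩
      · exact ⟨z, hz.subset⟩
    rcases hC.eq_empty_or_univ hz with h | h
    · exact h0 h
    · exact h1 h
  exact ncard_eq_two.1 h2

/-- Whitney's 2-isomorphism theorem for 2-connected labelled graphs. -/
theorem exists_reversals_lIso [Nonempty E] [Finite V] [Finite W] {f : E → Sym2 V}
    {g : E → Sym2 W} (hlf : Loopless f) (hlg : Loopless g) (hC : cutSpace f = cutSpace g)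
    (hconn : Conn (cutSpace f)) :
    ∃ f' g', ReflTransGen Reversal f f' ∧ ReflTransGen Reversal g g' ∧ LIso f' g' := by
  induction hn : (verts f).ncard using Nat.strong_induction_on generalizing f g with
  | _ n ih =>
  by_cases h3 : NoVertexPairCut f
  · exact ⟨f, g, .refl, .refl, lIso_of_noVertexPairCut hlf hlg hC hconn h3⟩
  obtain ⟨S, x, y, a, b, hxy, hS, ha, haS, hb, hbS⟩ := exists_separation hconn h3
  have hS0 : S ≠ ∅ := by
    rintro rfl
    obtain ⟨e, he⟩ := ha
    exact haS e (by simp) he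
  have hS1 : S ≠ univ := by
    rintro rfl
    obtain ⟨e, he⟩ := hb
    exact hbS e (by simp) he
  have hSc : boundary f Sᶜ = {x, y} := by rwa [boundary_compl]
  obtain ⟨g₁, hg₁, hg₁S⟩ := exists_reversals_ncard_boundary_le_two hlg (S := S) (hC ▸ hconn)
    (hC ▸ almostSplits_of_boundary hS.subset)
  have hCg₁ : cutSpace f = cutSpace g₁ := by rw [cutSpace_eq_of_reversals hg₁, hC]
  have hlg₁ := loopless_of_reversals hg₁ hlg
  obtain ⟨x₁, y₁, hxy₁, hS₁⟩ := (hCg₁ ▸ hconn).exists_boundary_eq_pair hS0 hS1 hg₁S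
  -- make the sides `S` isomorphic
  obtain ⟨h, k, hh, hk, hhk⟩ := ih _ (by
    rw [← hn, verts_collapse hS]
    refine ncard_lt_ncard ⟨?_, fun h => ?_⟩
    · rintro v ⟨e, -, he⟩
      exact ⟨e, he⟩
    · obtain ⟨e, he, hbe⟩ := h hb
      exact hbS e he hbe) (hlf.collapse hxy) (hlg₁.collapse hxy₁)
    (by rw [cutSpace_collapse hconn hS, cutSpace_collapse (hCg₁ ▸ hconn) hS₁, hCg₁])
    (hconn.collapse hlf hxy hS) rfl
  obtain ⟨f₂, x₂, y₂, hf₂, rfl⟩ := exists_lift_reversals hconn hxy hS hh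
  obtain ⟨g₂, x₂', y₂', hg₂, rfl⟩ := exists_lift_reversals (hCg₁ ▸ hconn) hxy₁ hS₁ hk
  have hCf₂ := cutSpace_eq_of_reversals hf₂.reversals
  have hCg₂ := cutSpace_eq_of_reversals hg₂.reversals
  have hconn₂ : Conn (cutSpace f₂) := hCf₂ ▸ hconn
  have hC₂ : cutSpace f₂ = cutSpace g₂ := by rw [hCf₂, hCg₂, hCg₁]
  have hlf₂ := loopless_of_reversals hf₂.reversals hlf
  have hlg₂ := loopless_of_reversals hg₂.reversals hlg₁
  have hSf₂ : boundary f₂ Sᶜ = {x₂, y₂} := by rw [boundary_compl, hf₂.boundary]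
  have hSg₂ : boundary g₂ Sᶜ = {x₂', y₂'} := by rw [boundary_compl, hg₂.boundary]
  -- Up to a permutation, the first lift has not changed the side outside `S`, so it still has fewer
  -- vertices than the original graph.
  obtain ⟨ρ, hρ⟩ := hf₂.iso
  obtain ⟨h, k, hh', hk', hhk'⟩ := ih _ (by
    rw [(lIso_of_equiv ρ hρ).ncard_verts, ← hn, verts_collapse hSc]
    refine ncard_lt_ncard ⟨?_, fun h => ?_⟩
    · rintro v ⟨e, -, he⟩
      exact ⟨e, he⟩
    · obtain ⟨e, he, hae⟩ := h ha
      exact haS e he hae) (hlf₂.collapse hf₂.ne) (hlg₂.collapse hg₂.ne)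
    (by rw [cutSpace_collapse hconn₂ hSf₂, cutSpace_collapse (hC₂ ▸ hconn₂) hSg₂, hC₂])
    (hconn₂.collapse hlf₂ hf₂.ne hSf₂) rfl
  obtain ⟨f₃, x₃, y₃, hf₃, rfl⟩ := exists_lift_reversals hconn₂ hf₂.ne hSf₂ hh'
  obtain ⟨g₃, x₃', y₃', hg₃, rfl⟩ := exists_lift_reversals (hC₂ ▸ hconn₂) hg₂.ne hSg₂ hk'
  -- The second lift changes the collapsed side `S` only by permutations, so the isomorphism found
  -- there survives.
  obtain ⟨ρ', hρ'⟩ := hf₃.iso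
  obtain ⟨τ', hτ'⟩ := hg₃.iso
  rw [compl_compl] at hρ' hτ'
  obtain ⟨f₄, hf₄, hiso⟩ := exists_reversals_lIso_of_sides (S := S) hf₃.ne
    (by rw [← boundary_compl, hf₃.boundary]) (by rw [← boundary_compl, hg₃.boundary])
    (((lIso_of_equiv ρ' hρ').symm.trans hhk).trans (lIso_of_equiv τ' hτ')) hhk'
  exact ⟨f₄, g₃, (hf₂.reversals.trans hf₃.reversals).trans hf₄,
    (hg₁.trans hg₂.reversals).trans hg₃.reversals, hiso⟩

end Collapse

/-! ### Blocks: lifting their reversals and splitting the graph into them. -/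

section Blocks

variable {E V W : Type*}

theorem Splits.compl {f : E → Sym2 V} {P : Set E} (h : Splits (cutSpace f) P) :
    Splits (cutSpace f) Pᶜ := by
  intro c hc
  obtain ⟨c', hc', h1, h2⟩ := h c hc
  refine ⟨_, cutSpace_xor hc hc', fun e he => ?_, fun e he => ?_⟩
  · rw [h2 e he, Bool.xor_false]
  · rw [h1 e (by simpa using he), Bool.xor_self]

theorem Splits.inter {C : Set (E → Bool)} {P Q : Set E} (hP : Splits C P) (hQ : Splits C Q) :
    Splits C (P ∩ Q) := by
  intro c hc
  obtain ⟨c', hc', h1, h2⟩ := hP c hc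
  obtain ⟨c'', hc'', h3, h4⟩ := hQ c' hc'
  refine ⟨c'', hc'', fun e he => ?_, fun e he => ?_⟩
  · rw [h3 e he.2, h1 e he.1]
  · by_cases heQ : e ∈ Q
    · rw [h3 e heQ, h2 e fun heP => he ⟨heP, heQ⟩]
    · exact h4 e heQ

theorem splits_univ (C : Set (E → Bool)) : Splits C univ :=
  fun c hc => ⟨c, hc, fun _ _ => rfl, fun e he => (he (mem_univ e)).elim⟩

theorem splits_sInter {C : Set (E → Bool)} {F : Set (Set E)} (hF : F.Finite)
    (h : ∀ P ∈ F, Splits C P) : Splits C (⋂₀ F) := by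
  induction F, hF using Set.Finite.induction_on with
  | empty => simpa using splits_univ C
  | insert _ _ ih =>
    rw [sInter_insert]
    exact (h _ (mem_insert _ _)).inter (ih fun P hP => h P (mem_insert_of_mem _ hP))

/-- The block of `e`: the edges not separated from `e` by any splitting of the space. -/
def block (C : Set (E → Bool)) (e : E) : Set E := {e' | ∀ P, Splits C P → (e ∈ P ↔ e' ∈ P)}

theorem mem_block_self (C : Set (E → Bool)) (e : E) : e ∈ block C e := fun _ _ => Iff.rfl

theorem block_eq {C : Set (E → Bool)} {e e' : E} (h : e' ∈ block C e) : block C e' = block C e := by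
  ext e''
  exact forall_congr' fun P => forall_congr' fun hP => by rw [h P hP]

theorem notMem_of_mem_block {C : Set (E → Bool)} {e e' e'' : E} (h : e' ∉ block C e)
    (h' : e'' ∈ block C e') : e'' ∉ block C e := by
  intro h''
  rw [← block_eq h'', block_eq h'] at h
  exact h (mem_block_self _ _)

/-- Splitting sets are closed under complements and finite intersections, and the block is the
intersection of those containing `e`. -/
theorem splits_block [Finite E] (f : E → Sym2 V) (e : E) :
    Splits (cutSpace f) (block (cutSpace f) e) := by
  have : block (cutSpace f) e = ⋂₀ {P | Splits (cutSpace f) P ∧ e ∈ P} := by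
    ext e'
    constructor
    · rintro h P ⟨hP, he⟩
      exact (h P hP).1 he
    · intro h P hP
      refine ⟨fun he => h P ⟨hP, he⟩, fun he' => ?_⟩
      by_contra he
      exact h Pᶜ ⟨hP.compl, he⟩ he'
  rw [this]
  exact splits_sInter (toFinite _) fun P hP => hP.1

/-- The labelled subgraph with edge set `B`. -/
def restrict (f : E → Sym2 V) (B : Set E) : B → Sym2 V := fun e => f e

theorem Loopless.restrict {f : E → Sym2 V} (hl : Loopless f) (B : Set E) :
    Loopless (restrict f B) := fun e => hl e

theorem cutSpace_restrict (f : E → Sym2 V) (B : Set E) :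
    cutSpace (restrict f B) = (fun c : E → Bool => fun e : B => c e) '' cutSpace f := by
  rw [cutSpace, cutSpace, ← range_comp]
  rfl

theorem cutSpace_restrict_congr {f : E → Sym2 V} {g : E → Sym2 W} (h : cutSpace f = cutSpace g)
    (B : Set E) : cutSpace (restrict f B) = cutSpace (restrict g B) := by
  rw [cutSpace_restrict, cutSpace_restrict, h]

/-- A splitting of the restricted space, composed with the splitting along the block, is a splitting
of the whole space, and no such splitting divides a block. -/
theorem conn_block [Finite E] (f : E → Sym2 V) (e₀ : E) :
    Conn (cutSpace (restrict f (block (cutSpace f) e₀))) := by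
  set B := block (cutSpace f) e₀
  have hB : Splits (cutSpace f) B := splits_block f e₀
  intro Q hQ
  have hsplit : Splits (cutSpace f) (Subtype.val '' Q) := by
    rintro _ ⟨p, rfl⟩
    obtain ⟨_, ⟨q, rfl⟩, h1, h2⟩ := hQ _ (coboundary_mem _ p)
    obtain ⟨c, hc, h3, h4⟩ := hB _ (coboundary_mem f q)
    refine ⟨c, hc, ?_, fun e he => ?_⟩
    · rintro _ ⟨e, he, rfl⟩
      rw [h3 e e.2]
      exact h1 e he
    · by_cases heB : e ∈ B
      · rw [h3 e heB]
        exact h2 ⟨e, heB⟩ fun h => he ⟨_, h, rfl⟩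
      · exact h4 e heB
  have key : ∀ e : B, e ∈ Q ↔ e₀ ∈ Subtype.val '' Q := by
    intro e
    rw [e.2 _ hsplit]
    simp
  by_cases h : e₀ ∈ Subtype.val '' Q
  · exact .inr (eq_univ_of_forall fun e => (key e).2 h)
  · exact .inl (eq_empty_of_forall_notMem fun e he => h ((key e).1 he))

theorem const_on_block [Finite E] {f : E → Sym2 V} (hl : Loopless f) {e₀ : E} {q : V → Bool}
    (hq : ∀ e ∈ block (cutSpace f) e₀, coboundary f q e = false) :
    ∃ t, ∀ e ∈ block (cutSpace f) e₀, ∀ v ∈ f e, q v = t := by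
  obtain ⟨t, ht⟩ := (conn_block f e₀).const (hl.restrict _) (q := q) fun e => hq e e.2
  exact ⟨t, fun e he v hv => ht v ⟨⟨e, he⟩, hv⟩⟩

/-- Any potential on the vertices of a block extends to a potential that is constant along all
edges outside the block. -/
theorem exists_block_potential [Finite E] {f : E → Sym2 V} (hl : Loopless f) (e₀ : E)
    (p : V → Bool) : ∃ q : V → Bool, (∀ e ∉ block (cutSpace f) e₀, coboundary f q e = false) ∧
      ∀ e ∈ block (cutSpace f) e₀, ∀ v ∈ f e, q v = p v := by
  obtain ⟨_, ⟨q, rfl⟩, h1, h2⟩ := splits_block f e₀ _ (coboundary_mem f p)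
  obtain ⟨t, ht⟩ := const_on_block hl (e₀ := e₀) (q := fun v => q v ^^ p v) fun e he => by
    rw [coboundary_xor, h1 e he, Bool.xor_self]
  refine ⟨fun v => q v ^^ t, fun e he => ?_, fun e he v hv => ?_⟩
  · rw [coboundary_xor, h2 e he, Bool.false_xor]
    obtain ⟨a, b, hab⟩ := exists_ends f e
    rw [coboundary_mk hab (fun _ => t), Bool.xor_self]
  · simp [← ht e he v hv]

/-- The labelled graphs are isomorphic on the edges in `B`. -/
def LIsoOn (B : Set E) (f : E → Sym2 V) (g : E → Sym2 W) : Prop :=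
  LIso (restrict f B) (restrict g B)

open Classical in
/-- A reversal of a block lifts to the graph. -/
theorem exists_block_lift [Finite E] {f : E → Sym2 V} (hl : Loopless f) {e₀ : E}
    {B : Set E} (hB : B = block (cutSpace f) e₀) {h : B → Sym2 V}
    (hh : Reversal (restrict f B) h) :
    ∃ f', Reversal f f' ∧ restrict f' B = h ∧
      ∀ e ∉ B, ∃ ρ : Equiv.Perm V,
        ∀ e' ∈ block (cutSpace f) e, f' e' = (f e').map ρ := by
  have hpot := exists_block_potential hl e₀
  simp only [← hB] at hpot
  obtain ⟨Q, a, b, hab, hQ, rfl⟩ := hh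
  -- The potential `q` extends the indicator of the vertices of `Q` other than `a` and `b`. Edges
  -- outside the block join `P` when `q` is true on them, so whatever hangs at these vertices is
  -- carried along by the reversal.
  obtain ⟨q, hq, hqB⟩ := hpot fun v => decide ((∃ e ∈ Q, v ∈ f e) ∧ v ≠ a ∧ v ≠ b)
  set P : Set E := {e | (∃ h : e ∈ B, ⟨e, h⟩ ∈ Q) ∨ e ∉ B ∧ ∀ v ∈ f e, q v = true} with hP
  have hPB : ∀ e (h : e ∈ B), e ∈ P ↔ ⟨e, h⟩ ∈ Q := by
    intro e h
    simp [hP, h]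
  have hPB' : ∀ e ∉ B, ∀ v ∈ f e, (e ∈ P ↔ q v = true) := by
    intro e h v hv
    simp only [hP, mem_ofPred_eq, h, IsEmpty.exists_iff, not_false_eq_true, true_and, false_or]
    refine ⟨fun h' => h' v hv, fun h' u hu => ?_⟩
    obtain ⟨w, hw⟩ := exists_other hv
    rw [hw, Sym2.mem_iff] at hu
    rcases hu with rfl | rfl
    · exact h'
    · rw [← h', eq_of_coboundary_eq_false hw (hq e h)]
  have hbd : boundary f P = {a, b} := by
    refine Subset.antisymm ?_ ?_
    · rintro v ⟨⟨e, he, hv⟩, e', he', hv'⟩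
      by_contra hno
      have hvQ : v ∉ boundary (restrict f B) Q := by rwa [hQ]
      simp only [mem_insert_iff, mem_singleton_iff, not_or] at hno
      by_cases heB : e ∈ B
      · have h1 : q v = true := by
          rw [hqB e heB v hv]
          simpa [hno] using ⟨e, ⟨heB, (hPB e heB).1 he⟩, hv⟩
        by_cases heB' : e' ∈ B
        · exact hvQ (mem_boundary ((hPB e heB).1 he) (fun h => he' ((hPB e' heB').2 h)) hv hv')
        · exact he' ((hPB' e' heB' v hv').2 h1)
      · have h1 : q v = true := (hPB' e heB v hv).1 he
        by_cases heB' : e' ∈ B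
        · rw [hqB e' heB' v hv', decide_eq_true_eq] at h1
          obtain ⟨⟨e'', he'', hv''⟩, -⟩ := h1
          exact hvQ (mem_boundary he'' (fun h => he' ((hPB e' heB').2 h)) hv'' hv')
        · exact he' ((hPB' e' heB' v hv').2 h1)
    · rw [← hQ]
      rintro v ⟨⟨e, he, hv⟩, e', he', hv'⟩
      exact mem_boundary (P := P) (e := e) (e' := e') ((hPB e e.2).2 he)
        (fun h => he' ((hPB e' e'.2).1 h)) hv hv'
  refine ⟨swapOn f P a b, ⟨P, a, b, hab, hbd, rfl⟩, funext fun e => ?_, fun e he => ?_⟩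
  · by_cases heQ : e ∈ Q
    · rw [swapOn_mem heQ]
      exact swapOn_mem ((hPB e e.2).2 heQ)
    · rw [swapOn_notMem heQ]
      exact swapOn_notMem fun h => heQ ((hPB e e.2).1 h)
  -- On any other block `q` is constant, so that block lies entirely inside or entirely outside `P`.
  · obtain ⟨t, ht⟩ := const_on_block hl (e₀ := e) (q := q) fun e' he' =>
      hq e' (hB ▸ notMem_of_mem_block (hB ▸ he) he')
    have key : ∀ e' ∈ block (cutSpace f) e, (e' ∈ P ↔ t = true) := by
      intro e' he'
      obtain ⟨v, _, hv⟩ := exists_ends f e'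
      rw [hPB' e' (hB ▸ notMem_of_mem_block (hB ▸ he) he') v (by simp [hv]), ht e' he' v (by simp [hv])]
    cases htt : t
    · refine ⟨1, fun e' he' => ?_⟩
      rw [swapOn_notMem (by rw [key e' he', htt]; simp)]
      simp
    · exact ⟨Equiv.swap a b, fun e' he' => swapOn_mem (by rw [key e' he', htt])⟩

theorem exists_block_lift_reversals [Finite E] {f : E → Sym2 V} (hl : Loopless f) {e₀ : E}
    {B : Set E} (hB : B = block (cutSpace f) e₀) {h : B → Sym2 V}
    (hh : ReflTransGen Reversal (restrict f B) h) :
    ∃ f', ReflTransGen Reversal f f' ∧ restrict f' B = h ∧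
      ∀ e ∉ B, ∃ ρ : Equiv.Perm V,
        ∀ e' ∈ block (cutSpace f) e, f' e' = (f e').map ρ := by
  induction hh with
  | refl => exact ⟨f, .refl, rfl, fun e _ => ⟨1, fun e' _ => by simp⟩⟩
  | tail _ h ih =>
    obtain ⟨f', h1, rfl, h2⟩ := ih
    have hC := cutSpace_eq_of_reversals h1
    obtain ⟨f'', h3, h4, h5⟩ := exists_block_lift (loopless_of_reversals h1 hl) (e₀ := e₀)
      (by rw [hC, hB]) h
    rw [hC] at h5
    refine ⟨f'', h1.tail h3, h4, fun e he => ?_⟩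
    obtain ⟨ρ, hρ⟩ := h2 e he
    obtain ⟨τ, hτ⟩ := h5 e he
    refine ⟨ρ.trans τ, fun e' he' => ?_⟩
    rw [hτ e' he', hρ e' he', Sym2.map_map]
    rfl

/-- After reversals, graphs with the same cut space have isomorphic blocks. -/
theorem exists_reversals_lIsoOn_block [Finite E] [Finite V] [Finite W] {f : E → Sym2 V}
    {g : E → Sym2 W} (hlf : Loopless f) (hlg : Loopless g) (hC : cutSpace f = cutSpace g) :
    ∃ f' g', ReflTransGen Reversal f f' ∧ ReflTransGen Reversal g g' ∧
      ∀ e, LIsoOn (block (cutSpace f) e) f' g' := by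
  classical
  suffices h : ∀ T : Finset E, ∃ f' g', ReflTransGen Reversal f f' ∧ ReflTransGen Reversal g g' ∧
      ∀ e ∈ T, LIsoOn (block (cutSpace f) e) f' g' by
    have := Fintype.ofFinite E
    obtain ⟨f', g', h1, h2, h3⟩ := h Finset.univ
    exact ⟨f', g', h1, h2, fun e => h3 e (Finset.mem_univ e)⟩
  intro T
  induction T using Finset.induction_on with
  | empty => exact ⟨f, g, .refl, .refl, by simp⟩
  | insert e₀ T _ ih =>
    obtain ⟨f₁, g₁, hf₁, hg₁, hT⟩ := ih
    have hlf₁ := loopless_of_reversals hf₁ hlf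
    have hlg₁ := loopless_of_reversals hg₁ hlg
    have hCf₁ := cutSpace_eq_of_reversals hf₁
    have hCg₁ := (cutSpace_eq_of_reversals hg₁).trans hC.symm
    have : Nonempty (block (cutSpace f) e₀) := ⟨⟨e₀, mem_block_self _ _⟩⟩
    have hconn := conn_block f₁ e₀
    rw [hCf₁] at hconn
    obtain ⟨h, k, hh, hk, hhk⟩ := exists_reversals_lIso (hlf₁.restrict (block (cutSpace f) e₀))
      (hlg₁.restrict _) (cutSpace_restrict_congr (hCf₁.trans hCg₁.symm) _) hconn
    obtain ⟨f₂, hf₂, rfl, hf₂'⟩ := exists_block_lift_reversals hlf₁ (by rw [hCf₁]) hh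
    obtain ⟨g₂, hg₂, rfl, hg₂'⟩ := exists_block_lift_reversals hlg₁ (by rw [hCg₁]) hk
    rw [hCf₁] at hf₂'
    rw [hCg₁] at hg₂'
    refine ⟨f₂, g₂, hf₁.trans hf₂, hg₁.trans hg₂, fun e he => ?_⟩
    by_cases heB : e ∈ block (cutSpace f) e₀
    · rw [block_eq heB]
      exact hhk
    · rw [Finset.mem_insert] at he
      rcases he with rfl | he
      · exact (heB (mem_block_self _ _)).elim
      -- A block treated earlier has been moved only by vertex permutations in both graphs.
      · obtain ⟨ρ, hρ⟩ := hf₂' e heB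
        obtain ⟨τ, hτ⟩ := hg₂' e heB
        have : Nonempty (block (cutSpace f) e) := ⟨⟨e, mem_block_self _ _⟩⟩
        have h1 : LIsoOn (block (cutSpace f) e) f₁ f₂ := lIso_of_equiv ρ fun e' => hρ e' e'.2
        have h2 : LIsoOn (block (cutSpace f) e) g₁ g₂ := lIso_of_equiv τ fun e' => hτ e' e'.2
        exact (LIso.trans (LIso.symm h1) (hT e he)).trans h2

open Classical in
/-- Break the vertex `x` into `some x` and `none`; the edges in `S` at `x` go to `none`. -/
noncomputable def splitAt (f : E → Sym2 V) (S : Set E) (x : V) : E → Sym2 (Option V) :=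
  fun e => if e ∈ S then (f e).map (fun a => if a = x then none else some a) else (f e).map some

open Classical in
theorem splitAt_mem {f : E → Sym2 V} {S : Set E} {x : V} {e : E} (h : e ∈ S) :
    splitAt f S x e = (f e).map (fun a => if a = x then none else some a) := by
  simp [splitAt, h]

theorem splitAt_notMem {f : E → Sym2 V} {S : Set E} {x : V} {e : E} (h : e ∉ S) :
    splitAt f S x e = (f e).map some := by
  simp [splitAt, h]

theorem splitFun_injective [DecidableEq V] (x : V) :
    Function.Injective fun a : V => if a = x then none else some a := by
  intro a b h
  by_cases ha : a = x <;> by_cases hb : b = x <;> simp_all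

/-- Identifying `none` with `x` undoes the split, so potentials and configurations pull back to the
split graph. -/
theorem splitAt_map_getD (f : E → Sym2 V) (S : Set E) (x : V) (e : E) :
    (splitAt f S x e).map (fun o => o.getD x) = f e := by
  by_cases h : e ∈ S
  · rw [splitAt_mem h, Sym2.map_map]
    refine sym2_map_eq_self fun v _ => ?_
    by_cases hv : v = x <;> simp [hv]
  · rw [splitAt_notMem h, Sym2.map_map]
    exact sym2_map_eq_self fun v _ => by simp

theorem Loopless.splitAt {f : E → Sym2 V} (hl : Loopless f) (S : Set E) (x : V) :
    Loopless (splitAt f S x) := by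
  intro e he
  refine hl e ?_
  rw [← splitAt_map_getD f S x e]
  exact he.map

/-- A potential on the split graph descends after a constant shift on the side `S` that equalizes
its values at the two copies of `x`. -/
theorem cutSpace_splitAt {f : E → Sym2 V} {S : Set E} {x : V} (hS : boundary f S = {x}) :
    cutSpace (splitAt f S x) = cutSpace f := by
  classical
  ext c
  constructor
  · rintro ⟨p, rfl⟩
    set q : V → Bool := fun v =>
      if ∃ e ∈ S, v ∈ f e then
        (p (if v = x then none else some v) ^^ (p none ^^ p (some x))) else p (some v) with hq
    refine ⟨q, funext fun e => ?_⟩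
    obtain ⟨a, b, hab⟩ := exists_ends f e
    by_cases he : e ∈ S
    · have h' := splitAt_mem (f := f) (x := x) he
      rw [hab, Sym2.map_mk] at h'
      rw [coboundary_mk hab, coboundary_mk h']
      have ha : ∃ e ∈ S, a ∈ f e := ⟨e, he, by simp [hab]⟩
      have hb : ∃ e ∈ S, b ∈ f e := ⟨e, he, by simp [hab]⟩
      simp only [hq, if_pos ha, if_pos hb]
      rw [xor_xor_cancel]
    · have key : ∀ u ∈ f e, q u = p (some u) := by
        intro u hu
        simp only [hq]
        split_ifs with h1 h2
        · subst h2
          simp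
        · have : u ∈ boundary f S := ⟨h1, e, he, hu⟩
          rw [hS] at this
          exact (h2 this).elim
        · rfl
      have h' := splitAt_notMem (f := f) (x := x) he
      rw [hab, Sym2.map_mk] at h'
      rw [coboundary_mk hab, coboundary_mk h', key a (by simp [hab]), key b (by simp [hab])]
  · rintro ⟨p, rfl⟩
    refine ⟨fun o => p (o.getD x), funext fun e => ?_⟩
    obtain ⟨a, b, hab⟩ := exists_ends (splitAt f S x) e
    have h' := splitAt_map_getD f S x e
    rw [hab, Sym2.map_mk] at h'
    rw [coboundary_mk hab, coboundary_mk h'.symm]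

/-- The space splits along `S`, so each block lies on one side, where the split is an injective
relabelling of vertices. -/
theorem lIsoOn_block_splitAt {f : E → Sym2 V} {S : Set E} {x : V} (hS : boundary f S = {x})
    (e : E) : LIsoOn (block (cutSpace f) e) f (splitAt f S x) := by
  classical
  have hsplit := splits_of_boundary_subset hS.subset
  by_cases he : e ∈ S
  · exact ⟨_, (splitFun_injective x).injOn, fun e' => splitAt_mem ((e'.2 S hsplit).1 he)⟩
  · exact ⟨_, (Option.some_injective V).injOn,
      fun e' => splitAt_notMem fun h => he ((e'.2 S hsplit).2 h)⟩

theorem verts_splitAt {f : E → Sym2 V} {S : Set E} {x : V} (hS : boundary f S = {x}) :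
    verts (splitAt f S x) = insert none (some '' verts f) := by
  classical
  have hx : x ∈ boundary f S := by simp [hS]
  ext o
  constructor
  · rintro ⟨e, he⟩
    by_cases heS : e ∈ S
    · rw [splitAt_mem heS, Sym2.mem_map] at he
      obtain ⟨a, ha, rfl⟩ := he
      by_cases hax : a = x
      · simp [hax]
      · rw [if_neg hax]
        exact .inr ⟨a, ⟨e, ha⟩, rfl⟩
    · rw [splitAt_notMem heS, Sym2.mem_map] at he
      obtain ⟨a, ha, rfl⟩ := he
      exact .inr ⟨a, ⟨e, ha⟩, rfl⟩
  · obtain ⟨⟨e₁, he₁, hx₁⟩, e₂, he₂, hx₂⟩ := hx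
    rintro (rfl | ⟨a, ⟨e, ha⟩, rfl⟩)
    · refine ⟨e₁, ?_⟩
      rw [splitAt_mem he₁, Sym2.mem_map]
      exact ⟨x, hx₁, by simp⟩
    · by_cases heS : e ∈ S
      · by_cases hax : a = x
        · refine ⟨e₂, ?_⟩
          rw [splitAt_notMem he₂, Sym2.mem_map]
          exact ⟨x, hx₂, by rw [hax]⟩
        · refine ⟨e, ?_⟩
          rw [splitAt_mem heS, Sym2.mem_map]
          exact ⟨a, ha, by simp [hax]⟩
      · refine ⟨e, ?_⟩
        rw [splitAt_notMem heS, Sym2.mem_map]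
        exact ⟨a, ha, rfl⟩

/-- No vertex lies in two blocks. -/
def FullySplit (f : E → Sym2 V) : Prop :=
  ∀ v e e', v ∈ f e → v ∈ f e' → e' ∈ block (cutSpace f) e

/-- At a vertex `x` in two blocks, take one block with everything that hangs on it at vertices other
than `x`. A potential extending the indicator of those vertices selects these edges. -/
theorem exists_boundary_eq_singleton [Finite E] {f : E → Sym2 V} (hl : Loopless f)
    (h : ¬ FullySplit f) : ∃ S x, boundary f S = {x} := by
  classical
  simp only [FullySplit, not_forall] at h
  obtain ⟨x, e₁, e₂, h₁, h₂, hne⟩ := h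
  obtain ⟨q, hq, hqB⟩ := exists_block_potential hl e₁ fun v => decide (v ≠ x)
  set B := block (cutSpace f) e₁
  have hB : e₁ ∈ B := mem_block_self _ _
  have hqx : q x = false := by simp [hqB e₁ hB x h₁]
  have key : ∀ e ∉ B, ∀ u ∈ f e, ∀ v ∈ f e, q u = q v := by
    intro e he u hu v hv
    obtain ⟨w, hw⟩ := exists_other hu
    rw [hw, Sym2.mem_iff] at hv
    rcases hv with rfl | rfl
    · rfl
    · exact eq_of_coboundary_eq_false hw (hq e he)
  refine ⟨{e | e ∈ B ∨ ∃ v ∈ f e, q v = true}, x, Subset.antisymm ?_ ?_⟩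
  · rintro v ⟨⟨e, he, hv⟩, e', he', hv'⟩
    by_contra hvx
    simp only [mem_ofPred_eq, not_or] at he'
    refine he'.2 ⟨v, hv', ?_⟩
    by_cases heB : e ∈ B
    · rw [hqB e heB v hv]
      simpa using hvx
    · obtain ⟨u, hu, hqu⟩ := he.resolve_left heB
      rw [key e heB v hv u hu, hqu]
  · rintro _ rfl
    refine mem_boundary (.inl hB) ?_ h₁ h₂
    rintro (h | ⟨v, hv, hqv⟩)
    · exact hne h
    · rw [key e₂ hne v hv _ h₂, hqx] at hqv
      exact absurd hqv (by simp)

/-- Fully split graphs with isomorphic blocks are isomorphic. -/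
theorem FullySplit.lIso [Nonempty E] {f : E → Sym2 V} {g : E → Sym2 W} (hf : FullySplit f)
    (hg : FullySplit g) (hC : cutSpace f = cutSpace g)
    (h : ∀ e, LIsoOn (block (cutSpace f) e) f g) : LIso f g := by
  have hW : Nonempty W := by
    obtain ⟨e⟩ := ‹Nonempty E›
    obtain ⟨a, _, _⟩ := exists_ends g e
    exact ⟨a⟩
  -- one isomorphism for each block
  have hσ : ∃ σ : Set E → V → W, ∀ e, InjOn (σ (block (cutSpace f) e))
      (verts (restrict f (block (cutSpace f) e))) ∧
      ∀ e' ∈ block (cutSpace f) e, g e' = (f e').map (σ (block (cutSpace f) e)) := by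
    -- The choice is indexed by the block as a set, so that all edges of a block receive the same
    -- isomorphism.
    have : ∀ B : Set E, ∃ σ : V → W, (∃ e, B = block (cutSpace f) e) →
        InjOn σ (verts (restrict f B)) ∧ ∀ e' ∈ B, g e' = (f e').map σ := by
      intro B
      by_cases hB : ∃ e, B = block (cutSpace f) e
      · obtain ⟨e, rfl⟩ := hB
        obtain ⟨σ, h1, h2⟩ := h e
        exact ⟨σ, fun _ => ⟨h1, fun e' he' => h2 ⟨e', he'⟩⟩⟩
      · exact ⟨fun _ => Classical.arbitrary W, fun h => (hB h).elim⟩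
    choose σ hσ using this
    exact ⟨σ, fun e => hσ _ ⟨e, rfl⟩⟩
  obtain ⟨σ, hσ⟩ := hσ
  have hE : ∀ v, ∃ e, v ∈ verts f → v ∈ f e := fun v => by
    by_cases hv : v ∈ verts f
    · obtain ⟨e, he⟩ := hv
      exact ⟨e, fun _ => he⟩
    · exact ⟨Classical.arbitrary E, fun h => (hv h).elim⟩
  choose ε hε using hE
  have key : ∀ e, ∀ v ∈ f e, σ (block (cutSpace f) (ε v)) v = σ (block (cutSpace f) e) v := by
    intro e v hv
    rw [block_eq (hf v e (ε v) hv (hε v ⟨e, hv⟩))]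
  have hmap : ∀ e, g e = (f e).map fun v => σ (block (cutSpace f) (ε v)) v := by
    intro e
    rw [(hσ e).2 e (mem_block_self _ _)]
    exact sym2_map_congr fun v hv => (key e v hv).symm
  refine ⟨fun v => σ (block (cutSpace f) (ε v)) v, ?_, hmap⟩
  rintro u ⟨e, hu⟩ v ⟨e', hv⟩ huv
  have h1 : σ (block (cutSpace f) (ε u)) u ∈ g e := by
    rw [hmap]
    exact Sym2.mem_map.2 ⟨u, hu, rfl⟩
  have h2 : σ (block (cutSpace f) (ε u)) u ∈ g e' := by
    rw [hmap]
    exact Sym2.mem_map.2 ⟨v, hv, huv.symm⟩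
  have h3 : e' ∈ block (cutSpace f) e := hC ▸ hg _ e e' h1 h2
  refine (hσ e).1 ⟨⟨e, mem_block_self _ _⟩, hu⟩ ⟨⟨e', h3⟩, hv⟩ ?_
  rw [← key e u hu, ← block_eq h3, ← key e' v hv]
  exact huv

end Blocks

/-! ### Measurement sets: invariance under reversals and splits, and recovery of the cut space. -/

section MeasurementSets

variable {E V W : Type*}

/-- The measurement set of a labelled graph. -/
def measurements (d : ℕ) (f : E → Sym2 V) : Set (E → ℝ) :=
  range fun (p : V → EuclideanSpace ℝ (Fin d)) (e : E) => sqLength p (f e)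

theorem sqLength_mk {d : ℕ} (p : V → EuclideanSpace ℝ (Fin d)) (a b : V) :
    sqLength p s(a, b) = dist (p a) (p b) ^ 2 := rfl

theorem sqLength_map {d : ℕ} (p : W → EuclideanSpace ℝ (Fin d)) (σ : V → W) (z : Sym2 V) :
    sqLength p (z.map σ) = sqLength (p ∘ σ) z := by
  induction z with
  | _ a b => rfl

theorem sqLength_eq {d : ℕ} {p : V → EuclideanSpace ℝ (Fin d)} {q : W → EuclideanSpace ℝ (Fin d)}
    {f : E → Sym2 V} {e : E} {σ : V → W}
    (h : ∀ a ∈ f e, ∀ b ∈ f e, dist (p a) (p b) = dist (q (σ a)) (q (σ b))) :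
    sqLength p (f e) = sqLength q ((f e).map σ) := by
  obtain ⟨a, b, hab⟩ := exists_ends f e
  rw [hab, Sym2.map_mk, sqLength_mk, sqLength_mk, h a (by simp [hab]) b (by simp [hab])]

/-- The point reflection exchanging `p a` and `p b` is an isometry. Applied to the side `P`, it
cancels the interchange of incidences and glues to the rest. -/
theorem measurements_swapOn_subset {d : ℕ} {f : E → Sym2 V} {P : Set E} {a b : V}
    (h : boundary f P = {a, b}) : measurements d (swapOn f P a b) ⊆ measurements d f := by
  classical
  rintro _ ⟨p, rfl⟩
  set q : V → EuclideanSpace ℝ (Fin d) := fun v =>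
    if ∃ e ∈ P, v ∈ f e then p a + p b - p (Equiv.swap a b v) else p v with hq
  refine ⟨q, funext fun e => ?_⟩
  by_cases he : e ∈ P
  · have key : ∀ u ∈ f e, q u = p a + p b - p (Equiv.swap a b u) := by
      intro u hu
      have : ∃ e ∈ P, u ∈ f e := ⟨e, he, hu⟩
      simp only [hq, if_pos this]
    show sqLength q (f e) = sqLength p (swapOn f P a b e)
    rw [swapOn_mem he]
    refine sqLength_eq fun u hu w hw => ?_
    rw [key u hu, key w hw, dist_sub_left]
  · have key : ∀ u ∈ f e, q u = p u := by
      intro u hu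
      simp only [hq]
      split_ifs with h1
      · have : u ∈ boundary f P := ⟨h1, e, he, hu⟩
        rw [h] at this
        rcases this with rfl | rfl <;> simp
      · rfl
    show sqLength q (f e) = sqLength p (swapOn f P a b e)
    obtain ⟨u, w, huw⟩ := exists_ends f e
    rw [swapOn_notMem he, huw, sqLength_mk, sqLength_mk, key u (by simp [huw]),
      key w (by simp [huw])]

theorem measurements_swapOn {d : ℕ} {f : E → Sym2 V} {P : Set E} {a b : V}
    (h : boundary f P = {a, b}) : measurements d (swapOn f P a b) = measurements d f := by
  refine (measurements_swapOn_subset h).antisymm ?_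
  have h2 : boundary (swapOn f P a b) P = {a, b} := by
    rw [boundary_swapOn (by simp [h]) (by simp [h]), h]
  have := measurements_swapOn_subset (d := d) h2
  rwa [swapOn_swapOn] at this

/-- Translating one side so that the two copies of `x` coincide changes no edge length. -/
theorem measurements_splitAt {d : ℕ} {f : E → Sym2 V} {S : Set E} {x : V}
    (hS : boundary f S = {x}) : measurements d (splitAt f S x) = measurements d f := by
  classical
  ext c
  constructor
  · rintro ⟨p, rfl⟩
    set q : V → EuclideanSpace ℝ (Fin d) := fun v =>
      if ∃ e ∈ S, v ∈ f e then
        p (if v = x then none else some v) + (p (some x) - p none) else p (some v) with hq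
    refine ⟨q, funext fun e => ?_⟩
    show sqLength q (f e) = sqLength p (splitAt f S x e)
    by_cases he : e ∈ S
    · have key : ∀ u ∈ f e, q u = p (if u = x then none else some u) + (p (some x) - p none) := by
        intro u hu
        have : ∃ e ∈ S, u ∈ f e := ⟨e, he, hu⟩
        simp only [hq, if_pos this]
      rw [splitAt_mem he]
      refine sqLength_eq fun u hu w hw => ?_
      rw [key u hu, key w hw, dist_add_right]
    · have key : ∀ u ∈ f e, q u = p (some u) := by
        intro u hu
        simp only [hq]
        split_ifs with h1 h2
        · subst h2
          simp
        · have : u ∈ boundary f S := ⟨h1, e, he, hu⟩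
          rw [hS] at this
          exact (h2 this).elim
        · rfl
      rw [splitAt_notMem he]
      refine sqLength_eq fun u hu w hw => ?_
      rw [key u hu, key w hw]
  · rintro ⟨p, rfl⟩
    refine ⟨fun o => p (o.getD x), funext fun e => ?_⟩
    show sqLength _ (splitAt f S x e) = sqLength p (f e)
    conv_rhs => rw [← splitAt_map_getD f S x e, sqLength_map]
    rfl

theorem exists_measurement_of_cut {d : ℕ} (hd : 1 ≤ d) (f : E → Sym2 V) (q : V → Bool) :
    ∃ x ∈ measurements d f, ∀ e, x e ≠ 0 ↔ coboundary f q e = true := by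
  set z : EuclideanSpace ℝ (Fin d) := EuclideanSpace.single ⟨0, hd⟩ 1 with hz
  have hz0 : z ≠ 0 := by
    intro h
    have : z ⟨0, hd⟩ = 0 := by rw [h]; rfl
    simp [hz] at this
  refine ⟨_, ⟨fun v => if q v = true then z else 0, rfl⟩, fun e => ?_⟩
  obtain ⟨a, b, hab⟩ := exists_ends f e
  simp only [hab, sqLength_mk, coboundary_mk hab]
  cases q a <;> cases q b <;> simp [hz0]

theorem exists_cut_of_measurement {d : ℕ} {f : E → Sym2 V} {x : E → ℝ}
    (hx : x ∈ measurements d f) {e₀ : E} (h₀ : x e₀ ≠ 0) :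
    ∃ q : V → Bool, coboundary f q e₀ = true ∧ ∀ e, coboundary f q e = true → x e ≠ 0 := by
  classical
  obtain ⟨p, rfl⟩ := hx
  obtain ⟨a₀, b₀, h₁⟩ := exists_ends f e₀
  refine ⟨fun v => decide (p v = p a₀), ?_, fun e he => ?_⟩
  · simp only [h₁, sqLength_mk] at h₀
    rw [coboundary_mk h₁]
    have : p b₀ ≠ p a₀ := by
      intro h
      simp [h] at h₀
    simp [this]
  · obtain ⟨a, b, hab⟩ := exists_ends f e
    rw [coboundary_mk hab] at he
    simp only [hab, sqLength_mk]
    have : p a ≠ p b := by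
      intro h
      simp [h] at he
    simpa [dist_eq_zero] using this

/-- By induction on the size of the cut: a cut that properly contains a nonempty cut is the sum of
two smaller ones, and a minimal cut is found by comparing supports of measurements. -/
theorem cutSpace_subset_of_measurements_eq [Finite E] {d : ℕ} (hd : 1 ≤ d) {f : E → Sym2 V}
    {g : E → Sym2 W} (h : measurements d f = measurements d g) : cutSpace f ⊆ cutSpace g := by
  intro c hc
  induction hn : {e | c e = true}.ncard using Nat.strong_induction_on generalizing c with
  | _ n ih =>
  by_cases h0 : ∃ e₀, c e₀ = true
  swap
  · refine ⟨fun _ => false, funext fun e => ?_⟩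
    obtain ⟨a, b, hab⟩ := exists_ends g e
    rw [coboundary_mk hab]
    by_contra hce
    exact h0 ⟨e, by simpa using Ne.symm hce⟩
  obtain ⟨e₀, he₀⟩ := h0
  by_cases hmin : ∃ c' ∈ cutSpace f, (∃ e, c' e = true) ∧ {e | c' e = true} ⊂ {e | c e = true}
  · obtain ⟨c', hc', ⟨e₁, he₁⟩, hlt⟩ := hmin
    have h1 := ih _ (hn ▸ ncard_lt_ncard hlt) hc' rfl
    have h2 := ih {e | (c e ^^ c' e) = true}.ncard (by
      rw [← hn]
      refine ncard_lt_ncard ⟨fun e he => ?_, fun hsub => ?_⟩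
      · by_contra hce
        have h3 : c' e ≠ true := fun h3 => hce (hlt.1 h3)
        have h4 : (c e ^^ c' e) = true := he
        simp only [mem_ofPred_eq] at hce
        simp [hce, h3] at h4
      · have h3 : (c e₁ ^^ c' e₁) = true := hsub (hlt.1 he₁)
        have h4 : c e₁ = true := hlt.1 he₁
        simp [h4, he₁] at h3) (cutSpace_xor hc hc') rfl
    have h3 := cutSpace_xor h1 h2
    convert h3 using 1
    funext e
    cases c e <;> cases c' e <;> rfl
  -- A measurement supported on the minimal cut contains a cut of `g` through `e₀`, which in turn
  -- contains a cut of `f` through `e₀`. Minimality makes all three equal.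
  · obtain ⟨p, rfl⟩ := hc
    obtain ⟨x, hx, hxp⟩ := exists_measurement_of_cut hd f p
    obtain ⟨q, hq₀, hq⟩ := exists_cut_of_measurement (h ▸ hx) ((hxp e₀).2 he₀)
    obtain ⟨y, hy, hyq⟩ := exists_measurement_of_cut hd g q
    obtain ⟨r, hr₀, hr⟩ := exists_cut_of_measurement (h ▸ hy) ((hyq e₀).2 hq₀)
    have h1 : ∀ e, coboundary f r e = true → coboundary g q e = true :=
      fun e he => (hyq e).1 (hr e he)
    have h2 : ∀ e, coboundary g q e = true → coboundary f p e = true :=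
      fun e he => (hxp e).1 (hq e he)
    refine ⟨q, funext fun e => ?_⟩
    rw [Bool.eq_iff_iff]
    refine ⟨h2 e, fun he => ?_⟩
    by_contra hne
    exact hmin ⟨_, coboundary_mem f r, ⟨e₀, hr₀⟩, fun e he => h2 e (h1 e he),
      fun hsub => hne (h1 e (hsub he))⟩

end MeasurementSets

/-! ### From labelled graphs back to simple graphs, and the two implications. -/

section SimpleGraphs

/-- The map `f` labels the edges of `G`. -/
def Labels {E V : Type*} (f : E → Sym2 V) (G : SimpleGraph V) : Prop :=
  Function.Injective f ∧ range f = G.edgeSet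

variable {E V W : Type*}

theorem Labels.loopless {f : E → Sym2 V} {G : SimpleGraph V} (h : Labels f G) : Loopless f :=
  fun e => G.not_isDiag_of_mem_edgeSet (h.2 ▸ mem_range_self e)

theorem labels_fromEdgeSet {f : E → Sym2 V} (hf : Function.Injective f) (hl : Loopless f) :
    Labels f (SimpleGraph.fromEdgeSet (range f)) := by
  refine ⟨hf, ?_⟩
  rw [SimpleGraph.edgeSet_fromEdgeSet]
  ext z
  constructor
  · rintro ⟨e, rfl⟩
    exact ⟨mem_range_self e, fun h => hl e h⟩
  · exact fun h => h.1

theorem Labels.adj_iff {f : E → Sym2 V} {G : SimpleGraph V} (h : Labels f G) {a b : V} :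
    G.Adj a b ↔ ∃ e, f e = s(a, b) := by
  rw [← SimpleGraph.mem_edgeSet, ← h.2]
  rfl

theorem Labels.isIsolated_eq {f : E → Sym2 V} {G : SimpleGraph V} (h : Labels f G) :
    {x | G.IsIsolated x} = (verts f)ᶜ := by
  ext x
  simp only [mem_ofPred_eq, SimpleGraph.IsIsolated, h.adj_iff, mem_compl_iff, verts]
  constructor
  · rintro h1 ⟨e, he⟩
    obtain ⟨b, hb⟩ := exists_other he
    exact h1 b ⟨e, hb⟩
  · rintro h1 b ⟨e, he⟩
    exact h1 ⟨e, by simp [he]⟩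

theorem labels_equiv (G : SimpleGraph V) {n : ℕ} (φ : G.edgeSet ≃ Fin n) :
    Labels (fun i => (φ.symm i : Sym2 V)) G := by
  refine ⟨Subtype.val_injective.comp φ.symm.injective, ?_⟩
  ext z
  constructor
  · rintro ⟨i, rfl⟩
    exact (φ.symm i).2
  · intro h
    exact ⟨φ ⟨z, h⟩, by simp⟩

theorem edgeVerts_image (f : E → Sym2 V) (P : Set E) :
    edgeVerts (f '' P) = {v | ∃ e ∈ P, v ∈ f e} := by
  ext v
  simp [edgeVerts]

theorem edgeVerts_inter (f : E → Sym2 V) (P : Set E) :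
    edgeVerts (f '' P) ∩ edgeVerts (f '' Pᶜ) = boundary f P := by
  rw [edgeVerts_image, edgeVerts_image]
  rfl

theorem Labels.isEdgePartition {f : E → Sym2 V} {G : SimpleGraph V} (h : Labels f G)
    (P : Set E) : IsEdgePartition G (f '' P) (f '' Pᶜ) := by
  refine ⟨?_, (disjoint_image_iff h.1).2 disjoint_compl_right⟩
  rw [← image_union, union_compl_self, image_univ, h.2]

theorem Labels.exists_image_eq {f : E → Sym2 V} {G : SimpleGraph V} (h : Labels f G)
    {S T : Set (Sym2 V)} (hST : IsEdgePartition G S T) : ∃ P : Set E, S = f '' P ∧ T = f '' Pᶜ := by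
  refine ⟨f ⁻¹' S, ?_, ?_⟩
  · rw [image_preimage_eq_inter_range, h.2, ← hST.1]
    simp
  · rw [← preimage_compl, image_preimage_eq_inter_range, h.2, ← hST.1]
    ext z
    simp only [mem_inter_iff, mem_compl_iff, mem_union]
    have : z ∈ S → z ∉ T := fun h => Set.disjoint_left.1 hST.2 h
    tauto

-- Reversal creates no parallel edges: an edge of `P` moved onto an edge outside `P` must join `a`
-- and `b`, hence was not moved at all.
open Classical in
theorem swapOn_injective {f : E → Sym2 V} (hf : Function.Injective f) (hl : Loopless f)
    {P : Set E} {a b : V} (h : boundary f P = {a, b}) : Function.Injective (swapOn f P a b) := by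
  have hcross : ∀ e ∈ P, ∀ e' ∉ P, (f e).map (Equiv.swap a b) ≠ f e' := by
    intro e he e' he' heq
    have key : ∀ u ∈ f e, u = a ∨ u = b := by
      intro u hu
      by_contra hno
      rw [not_or] at hno
      have h1 : u ∈ f e' := by
        rw [← heq, mem_map_swap, Equiv.swap_apply_of_ne_of_ne hno.1 hno.2]
        exact hu
      have h2 := mem_boundary he he' hu h1
      rw [h] at h2
      simp [hno] at h2
    obtain ⟨u, w, huw⟩ := exists_ends f e
    have hne := hl.ne huw
    have h3 : f e = s(a, b) := by
      have := key u (by simp [huw])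
      have := key w (by simp [huw])
      rw [huw, Sym2.eq_iff]
      grind
    rw [h3, Sym2.map_mk, Equiv.swap_apply_left, Equiv.swap_apply_right, Sym2.eq_swap, ← h3] at heq
    exact he' (hf heq ▸ he)
  intro e e' heq
  by_cases he : e ∈ P <;> by_cases he' : e' ∈ P
  · rw [swapOn_mem he, swapOn_mem he'] at heq
    exact hf (Sym2.map.injective (Equiv.injective _) heq)
  · rw [swapOn_mem he, swapOn_notMem he'] at heq
    exact (hcross e he e' he' heq).elim
  · rw [swapOn_notMem he, swapOn_mem he'] at heq
    exact (hcross e' he' e he heq.symm).elim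
  · rw [swapOn_notMem he, swapOn_notMem he'] at heq
    exact hf heq

theorem range_swapOn (f : E → Sym2 V) (P : Set E) (a b : V) :
    reversalGraph (f '' P) (f '' Pᶜ) a b = SimpleGraph.fromEdgeSet (range (swapOn f P a b)) := by
  classical
  rw [reversalGraph, image_image]
  congr 1
  ext z
  constructor
  · rintro (⟨e, he, rfl⟩ | ⟨e, he, rfl⟩)
    · exact ⟨e, swapOn_notMem he⟩
    · exact ⟨e, by rw [swapOn_mem he]⟩
  · rintro ⟨e, rfl⟩
    by_cases he : e ∈ P
    · exact .inr ⟨e, he, by rw [swapOn_mem he]⟩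
    · exact .inl ⟨e, he, (swapOn_notMem he).symm⟩

theorem Labels.swapOn {f : E → Sym2 V} {G : SimpleGraph V} (h : Labels f G) {P : Set E} {a b : V}
    (hab : a ≠ b) (hP : boundary f P = {a, b}) :
    Labels (swapOn f P a b) (reversalGraph (f '' P) (f '' Pᶜ) a b) := by
  rw [range_swapOn]
  exact labels_fromEdgeSet (swapOn_injective h.1 h.loopless hP)
    (Reversal.loopless ⟨P, a, b, hab, hP, rfl⟩ h.loopless)

theorem splitGraph_image (f : E → Sym2 V) (P : Set E) (x : V) :
    splitGraph x (f '' P) (f '' Pᶜ) = SimpleGraph.fromEdgeSet (range (splitAt f P x)) := by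
  classical
  rw [splitGraph, image_image, image_image]
  congr 1
  ext z
  constructor
  · rintro (⟨e, he, rfl⟩ | ⟨e, he, rfl⟩)
    · exact ⟨e, splitAt_notMem he⟩
    · exact ⟨e, by rw [splitAt_mem he]⟩
  · rintro ⟨e, rfl⟩
    by_cases he : e ∈ P
    · exact .inr ⟨e, he, by rw [splitAt_mem he]⟩
    · exact .inl ⟨e, he, (splitAt_notMem he).symm⟩

theorem Labels.splitAt {f : E → Sym2 V} {G : SimpleGraph V} (h : Labels f G) (P : Set E) (x : V) :
    Labels (splitAt f P x) (splitGraph x (f '' P) (f '' Pᶜ)) := by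
  rw [splitGraph_image]
  refine labels_fromEdgeSet (fun e e' heq => h.1 ?_) (h.loopless.splitAt P x)
  rw [← splitAt_map_getD f P x e, heq, splitAt_map_getD]

theorem Labels.isCutVertex {f : E → Sym2 V} {G : SimpleGraph V} (h : Labels f G) {P : Set E}
    {x : V} (hP : boundary f P = {x}) : IsCutVertex G x := by
  have hx : x ∈ boundary f P := by simp [hP]
  obtain ⟨⟨e₁, he₁, hx₁⟩, e₂, he₂, hx₂⟩ := id hx
  obtain ⟨a, ha⟩ := exists_other hx₁
  obtain ⟨b, hb⟩ := exists_other hx₂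
  have hax := h.loopless.ne ha
  have hbx := h.loopless.ne hb
  refine ⟨a, b, hax.symm, hbx.symm, ?_, ?_⟩
  · exact (h.adj_iff.2 ⟨e₁, ha⟩).symm.reachable.trans (h.adj_iff.2 ⟨e₂, hb⟩).reachable
  · intro hr
    have key : ∀ u w : {w | w ≠ x}, (G.induce {w | w ≠ x}).Reachable u w →
        (∃ e ∈ P, u.1 ∈ f e) → ∃ e ∈ P, w.1 ∈ f e := by
      rintro u w ⟨p⟩
      induction p with
      | nil => exact id
      | @cons u v w hadj _ ih =>
        rintro ⟨e, he, hu⟩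
        refine ih ?_
        obtain ⟨e', he'⟩ := h.adj_iff.1 (SimpleGraph.induce_adj.1 hadj)
        refine ⟨e', ?_, by simp [he']⟩
        by_contra hno
        have := mem_boundary he hno hu (by simp [he'])
        rw [hP] at this
        exact u.2 (by simpa using this)
    have h1 := key _ _ hr ⟨e₁, he₁, by simp [ha]⟩
    have h2 : b ∈ boundary f P := ⟨h1, e₂, he₂, by simp [hb]⟩
    rw [hP] at h2
    exact hbx h2.symm

theorem Labels.isSplitting {f : E → Sym2 V} {G : SimpleGraph V} (h : Labels f G) {P : Set E}
    {x : V} (hP : boundary f P = {x}) : IsSplitting G x (f '' P) (f '' Pᶜ) :=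
  ⟨h.isCutVertex hP, h.isEdgePartition P, (edgeVerts_inter f P).trans hP⟩

theorem boundary_map (f : E → Sym2 V) (σ : Equiv.Perm V) (P : Set E) :
    boundary (fun e => (f e).map σ) P = σ '' boundary f P := by
  ext v
  have key : ∀ e, v ∈ (f e).map σ ↔ σ.symm v ∈ f e := by
    intro e
    rw [Sym2.mem_map]
    constructor
    · rintro ⟨u, hu, rfl⟩
      simpa using hu
    · intro h
      exact ⟨_, h, by simp⟩
  rw [Equiv.image_eq_preimage_symm]
  exact and_congr (exists_congr fun e => and_congr_right fun _ => key e)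
    (exists_congr fun e => and_congr_right fun _ => key e)

open Classical in
theorem swapOn_map (f : E → Sym2 V) (σ : Equiv.Perm V) (P : Set E) (a b : V) :
    swapOn (fun e => (f e).map σ) P (σ a) (σ b) = fun e => (swapOn f P a b e).map σ := by
  funext e
  by_cases he : e ∈ P
  · rw [swapOn_mem he, swapOn_mem he, Sym2.map_map, Sym2.map_map]
    refine sym2_map_congr fun v _ => ?_
    exact (σ.injective.map_swap a b v).symm
  · rw [swapOn_notMem he, swapOn_notMem he]

theorem eq_of_encard_lt_two {f : E → Sym2 V} {P : Set E} {a b : V}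
    (hab : a ≠ b) (ha : a ∈ boundary f P) (hb : b ∈ boundary f P) (hP : ¬ 2 ≤ P.encard) :
    ∀ e ∈ P, f e = s(a, b) := by
  intro e he
  have hsub : P.Subsingleton := by
    rw [← encard_le_one_iff_subsingleton]
    exact Order.le_of_lt_add_one (by simpa [one_add_one_eq_two] using hP)
  obtain ⟨⟨e₁, he₁, h₁⟩, -⟩ := ha
  obtain ⟨⟨e₂, he₂, h₂⟩, -⟩ := hb
  rw [hsub he₁ he] at h₁
  rw [hsub he₂ he] at h₂
  exact (Sym2.mem_and_mem_iff hab).1 ⟨h₁, h₂⟩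

open Classical in
/-- Reversals of labelled graphs are reversals of simple graphs up to isomorphism. -/
theorem Labels.exists_isReversals {f f' : E → Sym2 V} {G : SimpleGraph V} (h : Labels f G)
    (hf : ReflTransGen Reversal f f') :
    ∃ (G' : SimpleGraph V) (ρ : Equiv.Perm V), ReflTransGen IsReversal G G' ∧
      Labels (fun e => (f' e).map ρ) G' := by
  induction hf with
  | refl => exact ⟨G, 1, .refl, by simpa using h⟩
  | @tail f₁ f₂ _ h' ih =>
    obtain ⟨G', ρ, hG', hlab⟩ := ih
    obtain ⟨P, a, b, hab, hP, rfl⟩ := h'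
    have ha : a ∈ boundary f₁ P := by simp [hP]
    have hb : b ∈ boundary f₁ P := by simp [hP]
    have hne : ρ a ≠ ρ b := by simpa using hab
    have hP' : boundary (fun e => (f₁ e).map ρ) P = {ρ a, ρ b} := by
      rw [boundary_map, hP, image_pair]
    by_cases h1 : 2 ≤ P.encard
    · by_cases h2 : 2 ≤ Pᶜ.encard
      · have h3 := hlab.swapOn hne hP'
        rw [swapOn_map] at h3
        refine ⟨_, ρ, hG'.tail ⟨_, _, ρ a, ρ b, ⟨hlab.isEdgePartition P, ?_, ?_, hne, ?_⟩, rfl⟩, h3⟩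
        · rwa [hlab.1.encard_image]
        · rwa [hlab.1.encard_image]
        · rw [edgeVerts_inter, hP']
      -- Too few edges for a 2-separation: any edge outside `P` joins `a` and `b`, so the reversal
      -- is a permutation of all vertices, absorbed into `ρ`. If instead `P` is too small, the
      -- reversal changes nothing.
      · refine ⟨G', (Equiv.swap a b).trans ρ, hG', ?_⟩
        convert hlab using 2 with e
        rw [Equiv.coe_trans, ← Sym2.map_map]
        congr 1
        by_cases he : e ∈ P
        · rw [swapOn_mem he, Sym2.map_map]
          exact sym2_map_eq_self fun v _ => by simp
        · rw [swapOn_notMem he, eq_of_encard_lt_two (f := f₁) (P := Pᶜ) hab (by rwa [boundary_compl])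
            (by rwa [boundary_compl]) h2 e he]
          simp [Sym2.eq_swap]
    · refine ⟨G', ρ, hG', ?_⟩
      convert hlab using 3 with e
      by_cases he : e ∈ P
      · rw [swapOn_mem he, eq_of_encard_lt_two hab ha hb h1 e he]
        simp [Sym2.eq_swap]
      · rw [swapOn_notMem he]

theorem ncard_verts_le [Finite E] (f : E → Sym2 V) : (verts f).ncard ≤ Nat.card (E × Bool) := by
  choose a b hab using exists_ends f
  have : verts f ⊆ range fun x : E × Bool => cond x.2 (a x.1) (b x.1) := by
    rintro v ⟨e, he⟩
    rw [hab, Sym2.mem_iff] at he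
    rcases he with rfl | rfl
    · exact ⟨(e, true), rfl⟩
    · exact ⟨(e, false), rfl⟩
  exact (ncard_le_ncard this (toFinite _)).trans (by
    rw [← Nat.card_coe_set_eq]
    exact Finite.card_range_le _)

theorem ncard_compl_verts_splitAt {f : E → Sym2 V} {S : Set E} {x : V}
    (hS : boundary f S = {x}) : (verts (splitAt f S x))ᶜ.ncard = (verts f)ᶜ.ncard := by
  have : (verts (splitAt f S x))ᶜ = some '' (verts f)ᶜ := by
    rw [verts_splitAt hS]
    ext o
    cases o <;> simp
  rw [this, ncard_image_of_injective _ (Option.some_injective V)]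

/-- Every graph splits into its blocks. -/
theorem Labels.exists_splitsTo_fullySplit [Finite E] {V : Type u} [Finite V] {f : E → Sym2 V}
    {G : SimpleGraph V} (h : Labels f G) :
    ∃ (V' : Type u) (_ : Finite V') (G' : SimpleGraph V') (f' : E → Sym2 V'), SplitsTo G G' ∧
      Labels f' G' ∧ FullySplit f' ∧ cutSpace f' = cutSpace f ∧
      (∀ e, LIsoOn (block (cutSpace f) e) f f') ∧ (verts f')ᶜ.ncard = (verts f)ᶜ.ncard := by
  induction hn : Nat.card (E × Bool) - (verts f).ncard using Nat.strong_induction_on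
    generalizing V with
  | _ n ih =>
  by_cases hfs : FullySplit f
  · exact ⟨V, inferInstance, G, f, .refl G, h, hfs, rfl, fun _ => LIso.refl _, rfl⟩
  obtain ⟨S, x, hS⟩ := exists_boundary_eq_singleton h.loopless hfs
  -- Each split adds one non-isolated vertex, and their number never exceeds twice the number of
  -- edges.
  have hlt : Nat.card (E × Bool) - (verts (MeasIso.splitAt f S x)).ncard < n := by
    have h1 := ncard_verts_le (MeasIso.splitAt f S x)
    have h2 : (verts (MeasIso.splitAt f S x)).ncard = (verts f).ncard + 1 := by
      rw [verts_splitAt hS, ncard_insert_of_notMem (by simp),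
        ncard_image_of_injective _ (Option.some_injective V)]
    omega
  obtain ⟨V', hV', G', f', h1, h2, h3, h4, h5, h6⟩ := ih _ hlt (h.splitAt S x) rfl
  have hC := cutSpace_splitAt hS
  rw [hC] at h4 h5
  exact ⟨V', hV', G', f', .step G x _ _ G' (h.isSplitting hS) h1, h2, h3, h4,
    fun e => (lIsoOn_block_splitAt hS e).trans (h5 e),
    h6.trans (ncard_compl_verts_splitAt hS)⟩

/-- A bijection of the isolated vertices completes the isomorphism. Without edges the hypothesis
gives no vertex map, so that case is treated directly. -/
theorem LIso.exists_equiv [Finite V] [Finite W] {f : E → Sym2 V} {g : E → Sym2 W}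
    (h : Nonempty E → LIso f g) (hiso : (verts f)ᶜ.ncard = (verts g)ᶜ.ncard) :
    ∃ ε : V ≃ W, ∀ e, g e = (f e).map ε := by
  classical
  obtain ⟨ε₂⟩ : Nonempty (((verts f)ᶜ : Set V) ≃ ((verts g)ᶜ : Set W)) := by
    rw [← Nat.card_coe_set_eq, ← Nat.card_coe_set_eq] at hiso
    exact Finite.card_eq.1 hiso
  obtain ⟨ε₁, hε₁⟩ : ∃ ε₁ : verts f ≃ verts g,
      ∀ e, g e = (f e).map fun v => if hv : v ∈ verts f then (ε₁ ⟨v, hv⟩ : W) else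
        (ε₂ ⟨v, hv⟩ : W) := by
    by_cases hE : Nonempty E
    · obtain ⟨σ, hσ, hfg⟩ := h hE
      have hb : BijOn σ (verts f) (verts g) := by
        rw [verts_map hfg]
        exact hσ.bijOn_image
      refine ⟨hb.equiv σ, fun e => ?_⟩
      rw [hfg]
      refine sym2_map_congr fun v hv => ?_
      rw [dif_pos ⟨e, hv⟩]
      rfl
    · have h1 : IsEmpty (verts f) := ⟨fun ⟨_, e, _⟩ => hE ⟨e⟩⟩
      have h2 : IsEmpty (verts g) := ⟨fun ⟨_, e, _⟩ => hE ⟨e⟩⟩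
      exact ⟨Equiv.equivOfIsEmpty _ _, fun e => (hE ⟨e⟩).elim⟩
  refine ⟨(Equiv.Set.sumCompl (verts f)).symm.trans
    ((Equiv.sumCongr ε₁ ε₂).trans (Equiv.Set.sumCompl (verts g))), fun e => ?_⟩
  rw [hε₁]
  refine sym2_map_congr fun v hv => ?_
  have hv' : v ∈ verts f := ⟨e, hv⟩
  simp [dif_pos hv', Equiv.Set.sumCompl_symm_apply_of_mem hv']

theorem Labels.nonempty_iso {f : E → Sym2 V} {g : E → Sym2 W} {G : SimpleGraph V}
    {H : SimpleGraph W} (hf : Labels f G) (hg : Labels g H) (ε : V ≃ W)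
    (h : ∀ e, g e = (f e).map ε) : Nonempty (G ≃g H) := by
  refine ⟨ε, fun {a b} => ?_⟩
  rw [hf.adj_iff, hg.adj_iff]
  refine exists_congr fun e => ?_
  rw [h, ← Sym2.map_mk]
  exact (Sym2.map.injective ε.injective).eq_iff

theorem cutSpace_map (f : E → Sym2 V) (ε : V ≃ W) :
    cutSpace (fun e => (f e).map ε) = cutSpace f := by
  have key : ∀ p e, coboundary (fun e => (f e).map ε) p e = coboundary f (p ∘ ε) e := by
    intro p e
    obtain ⟨a, b, hab⟩ := exists_ends f e
    rw [coboundary_mk hab, coboundary_mk (a := ε a) (b := ε b) (by rw [hab, Sym2.map_mk])]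
    rfl
  ext c
  constructor
  · rintro ⟨p, rfl⟩
    exact ⟨p ∘ ε, funext fun e => (key p e).symm⟩
  · rintro ⟨p, rfl⟩
    refine ⟨p ∘ ε.symm, funext fun e => ?_⟩
    rw [key, Function.comp_assoc]
    simp

theorem ncard_compl_verts_map {f : E → Sym2 V} (ρ : Equiv.Perm V) :
    (verts fun e => (f e).map ρ)ᶜ.ncard = (verts f)ᶜ.ncard := by
  rw [verts_map (f := f) (σ := ρ) fun _ => rfl, ← image_compl_eq ρ.bijective,
    ncard_image_of_injective _ ρ.injective]

theorem Labels.twoIsomorphic {n : ℕ} {V : Type u} {W : Type v} [Finite V] [Finite W]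
    {f : Fin n → Sym2 V} {g : Fin n → Sym2 W} {G : SimpleGraph V} {H : SimpleGraph W}
    (hf : Labels f G) (hg : Labels g H) (hC : cutSpace f = cutSpace g)
    (hiso : (verts f)ᶜ.ncard = (verts g)ᶜ.ncard) : TwoIsomorphic G H := by
  obtain ⟨f₁, g₁, hf₁, hg₁, h₁⟩ := exists_reversals_lIsoOn_block hf.loopless hg.loopless hC
  obtain ⟨G₂, ρ, hG₂, hf₂⟩ := hf.exists_isReversals hf₁
  obtain ⟨H₂, τ, hH₂, hg₂⟩ := hg.exists_isReversals hg₁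
  obtain ⟨V', _, G₃, f₃, hG₃, hf₃, hfs, hCf₃, hLf, hnf⟩ := hf₂.exists_splitsTo_fullySplit
  obtain ⟨W', _, H₃, g₃, hH₃, hg₃, hgs, hCg₃, hLg, hng⟩ := hg₂.exists_splitsTo_fullySplit
  have hCf₂ : cutSpace (fun e => (f₁ e).map ρ) = cutSpace f := by
    rw [← cutSpace_eq_of_reversals hf₁, cutSpace_map]
  have hCg₂ : cutSpace (fun e => (g₁ e).map τ) = cutSpace f := by
    rw [hC, ← cutSpace_eq_of_reversals hg₁, cutSpace_map]
  rw [hCf₂] at hCf₃ hLf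
  rw [hCg₂] at hCg₃ hLg
  have hL : ∀ e, LIsoOn (block (cutSpace f₃) e) f₃ g₃ := by
    intro e
    rw [hCf₃]
    have : Nonempty (block (cutSpace f) e) := ⟨⟨e, mem_block_self _ _⟩⟩
    have h2 : LIsoOn (block (cutSpace f) e) f₁ fun e => (f₁ e).map ρ :=
      lIso_of_equiv ρ fun _ => rfl
    have h3 : LIsoOn (block (cutSpace f) e) g₁ fun e => (g₁ e).map τ :=
      lIso_of_equiv τ fun _ => rfl
    exact (LIso.symm (LIso.trans h2 (hLf e))).trans ((h₁ e).trans (LIso.trans h3 (hLg e)))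
  obtain ⟨ε, hε⟩ := LIso.exists_equiv
    (fun _ => hfs.lIso hgs (hCf₃.trans hCg₃.symm) hL) (by
      rw [hnf, hng, ncard_compl_verts_map, ncard_compl_verts_map, verts_eq_of_reversals hf₁,
        verts_eq_of_reversals hg₁, hiso])
  exact ⟨G₂, H₂, hG₂, hH₂, V', G₃, W', H₃, hG₃, hH₃, hf₃.nonempty_iso hg₃ ε hε⟩

theorem Labels.of_isReversals {d : ℕ} {f : E → Sym2 V} {G G' : SimpleGraph V} (h : Labels f G)
    (hG : ReflTransGen IsReversal G G') :
    ∃ f' : E → Sym2 V, Labels f' G' ∧ measurements d f' = measurements d f := by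
  induction hG with
  | refl => exact ⟨f, h, rfl⟩
  | tail _ hrev ih =>
    obtain ⟨f', h', hM⟩ := ih
    obtain ⟨S, T, x, y, ⟨hST, -, -, hxy, hinter⟩, rfl⟩ := hrev
    obtain ⟨P, rfl, rfl⟩ := h'.exists_image_eq hST
    rw [edgeVerts_inter] at hinter
    exact ⟨_, h'.swapOn hxy hinter, (measurements_swapOn hinter).trans hM⟩

theorem Labels.of_splitsTo {d : ℕ} {V V' : Type u} {G : SimpleGraph V} {G' : SimpleGraph V'}
    (hG : SplitsTo G G') {f : E → Sym2 V} (h : Labels f G) :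
    ∃ f' : E → Sym2 V', Labels f' G' ∧ measurements d f' = measurements d f := by
  induction hG with
  | refl => exact ⟨f, h, rfl⟩
  | step G x S T H hsplit _ ih =>
    obtain ⟨-, hST, hinter⟩ := hsplit
    obtain ⟨P, rfl, rfl⟩ := h.exists_image_eq hST
    rw [edgeVerts_inter] at hinter
    obtain ⟨f', h', hM⟩ := ih (h.splitAt P x)
    exact ⟨f', h', hM.trans (measurements_splitAt hinter)⟩

theorem measurements_map {d : ℕ} (f : E → Sym2 V) (ε : V ≃ W) :
    measurements d (fun e => (f e).map ε) = measurements d f := by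
  ext c
  constructor
  · rintro ⟨p, rfl⟩
    exact ⟨p ∘ ε, funext fun e => (sqLength_map p ε (f e)).symm⟩
  · rintro ⟨p, rfl⟩
    refine ⟨p ∘ ε.symm, funext fun e => ?_⟩
    show sqLength _ ((f e).map ε) = _
    rw [sqLength_map, Function.comp_assoc]
    simp

theorem measurements_comp {d : ℕ} {E' : Type*} (f : E → Sym2 V) (ρ : E' → E) :
    measurements d (f ∘ ρ) = (fun c => c ∘ ρ) '' measurements d f := by
  rw [measurements, measurements, ← range_comp]
  rfl

theorem Labels.exists_comp_eq {E' : Type*} {f : E → Sym2 V} {g : E' → Sym2 V}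
    {G : SimpleGraph V} (hf : Labels f G) (hg : Labels g G) : ∃ ρ : E ≃ E', f = g ∘ ρ := by
  refine ⟨(Equiv.ofInjective f hf.1).trans ((Equiv.setCongr (hf.2.trans hg.2.symm)).trans
    (Equiv.ofInjective g hg.1).symm), funext fun e => ?_⟩
  simp [Equiv.apply_ofInjective_symm]

theorem Labels.map_iso {f : E → Sym2 V} {G : SimpleGraph V} {H : SimpleGraph W}
    (hf : Labels f G) (ε : G ≃g H) : Labels (fun e => (f e).map ε.toEquiv) H := by
  refine ⟨(Sym2.map.injective ε.toEquiv.injective).comp hf.1, ?_⟩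
  ext z
  induction z with
  | _ a b =>
    rw [SimpleGraph.mem_edgeSet, ← ε.symm.map_adj_iff, hf.adj_iff]
    refine exists_congr fun e => ?_
    constructor
    · intro h
      have := congrArg (Sym2.map ε.symm) h
      rw [Sym2.map_map, Sym2.map_mk] at this
      rw [← this]
      exact (sym2_map_eq_self fun v _ => by simp).symm
    · intro h
      simp [h]

theorem Labels.symm_labels {f : E → Sym2 V} {G : SimpleGraph V} (hf : Labels f G) {n : ℕ}
    (ρ : E ≃ Fin n) : ∃ φ : G.edgeSet ≃ Fin n, (fun i => (φ.symm i : Sym2 V)) = f ∘ ρ.symm :=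
  ⟨((Equiv.ofInjective f hf.1).trans (Equiv.setCongr hf.2)).symm.trans ρ, by
    funext i
    simp⟩

theorem measurementIsomorphic_of_twoIsomorphic {V : Type u} {W : Type v} [Finite V] [Finite W]
    (d : ℕ) {G : SimpleGraph V} {H : SimpleGraph W} (h : TwoIsomorphic G H) :
    MeasurementIsomorphic d G H := by
  obtain ⟨G₁, H₁, hG₁, hH₁, V', G₂, W', H₂, hG₂, hH₂, ⟨ε⟩⟩ := h
  obtain ⟨n, ⟨φ⟩⟩ := Finite.exists_equiv_fin G.edgeSet
  obtain ⟨m, ⟨ψ⟩⟩ := Finite.exists_equiv_fin H.edgeSet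
  have hf := labels_equiv G φ
  have hg := labels_equiv H ψ
  obtain ⟨f₁, hf₁, hMf₁⟩ := hf.of_isReversals (d := d) hG₁
  obtain ⟨g₁, hg₁, hMg₁⟩ := hg.of_isReversals (d := d) hH₁
  obtain ⟨f₂, hf₂, hMf₂⟩ := Labels.of_splitsTo (d := d) hG₂ hf₁
  obtain ⟨g₂, hg₂, hMg₂⟩ := Labels.of_splitsTo (d := d) hH₂ hg₁
  -- The final graphs carry two labellings of the same edges; `ρ` compares them and yields the
  -- identification of the edges of `H` with the axes.
  obtain ⟨ρ, hρ⟩ := (hf₂.map_iso ε).exists_comp_eq hg₂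
  obtain ⟨ψ', hψ'⟩ := hg.symm_labels ρ.symm
  refine ⟨n, φ, ψ', ?_⟩
  show measurements d (fun i => (φ.symm i : Sym2 V)) =
    measurements d (fun i => (ψ'.symm i : Sym2 W))
  rw [hψ', measurements_comp, ← hMg₁, ← hMg₂, ← hMf₁, ← hMf₂, ← measurements_map f₂ ε.toEquiv, hρ,
    measurements_comp]
  rfl

end SimpleGraphs

end MeasIso

theorem mainTheorem1 {V : Type u} {W : Type v} [Finite V] [Finite W] (d : ℕ) (hd : 1 ≤ d)
    (Γ : SimpleGraph V) (Δ : SimpleGraph W)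
    (hiso : {x | Γ.IsIsolated x}.ncard = {y | Δ.IsIsolated y}.ncard) :
    MeasIso.MeasurementIsomorphic d Γ Δ ↔ MeasIso.TwoIsomorphic Γ Δ := by
  refine ⟨?_, MeasIso.measurementIsomorphic_of_twoIsomorphic d⟩
  rintro ⟨n, φ, ψ, h⟩
  have hf := MeasIso.labels_equiv Γ φ
  have hg := MeasIso.labels_equiv Δ ψ
  rw [hf.isIsolated_eq, hg.isIsolated_eq] at hiso
  exact hf.twoIsomorphic hg ((MeasIso.cutSpace_subset_of_measurements_eq hd h).antisymm
    (MeasIso.cutSpace_subset_of_measurements_eq hd h.symm)) hiso
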